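/- Let $d\ge 1$, let $m$ be Lebesgue measure on $\mathbb R^d$ and $\operatorname{dist}$ the Euclidean distance. For $A\subset\mathbb R^d$ and $\varepsilon>0$ put $\partial_\varepsilon A=\{x\in A:\operatorname{dist}(x,\partial A)<\varepsilon\}$, where $\partial A$ is the topological boundary. Setting. Let $X\subset\mathbb R^d$ be bounded and Borel with $m(X)>0$ and $\sup_{\varepsilon>0}m(\partial_\varepsilon X)/\varepsilon<\infty$. Let $T$ be a measurable non-singular piecewise invertible map of $X$ with respect to a countable (mod 0)-partition $\mathcal P=\{O_h\}_{h\in\mathcal H}$ of $X$ into non-empty open sets: $T$ maps each $O_h$ homeomorphically onto an open set $T(O_h)\subset X$, and $T_*(m|_{O_h})$ is equivalent to $m|_{T(O_h)}$. Write $h:T(O_h)\to O_h$ for the inverse branch and $Jh=d(m\circ h)/dm$; let $\mathcal H^n$ be the set of inverse branches of $T^n$, with ranges $O_h$, $h\in\mathcal H^n$ (the elements of $\mathcal P^n$). Assume: 1. (Uniform expansion) There are $\lambda\in(0,1)$ and $\varepsilon_1>0$ with $\operatorname{dist}(h(x),h(y))\le\lambda\operatorname{dist}(x,y)$ for all $h\in\mathcal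 H$ and $x,y\in T(O_h)$ with $\operatorname{dist}(x,y)\le\varepsilon_1$. 2. (Bounded distortion) There are $\alpha\in(0,1]$ and $D\ge0$ with $Jh(x)\le e^{D\operatorname{dist}(x,y)^\alpha}Jh(y)$ for all $h\in\mathcal H$ and $x,y\in T(O_h)$. 3. (Controlled complexity) There are $n_0\in\mathbb N$, $\varepsilon_2>0$, $0\le\sigma<\lambda^{-n_0}-1$ and $\bar C<\infty$ such that for every open $I\subset X$ with $\operatorname{diam}I\le\varepsilon_2$ and every $0<\varepsilon<\varepsilon_2$, the expression $$\sum_{h\in\mathcal H^{n},\ m(I\cap O_h)>0}\frac{m\big(h(\partial_\varepsilon T^{n}(I\cap O_h))\setminus\partial_{\lambda^{n}\varepsilon}I\big)}{m(\partial_{\lambda^{n}\varepsilon}I)}$$ is at most $\sigma$ for $n=n_0$ and at most $\bar C$ for every $1\le n<n_0$. Assume in addition that $(T,m)$ is ergodic, i.e. every measurable set $A$ with $T^{-1}A=A$ satisfies $m(A\cap X)=0$ or $m(X\setminus A)=0$ ($m$ is not assumed to be invariant). For an open set $Z\subset X$, say that $T$ has a *full-branched Gibbs–Markov inducing scheme on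 $Z$ with exponential tails* if there are a refinement $\mathcal P''$ of $\mathcal P$ into open sets (mod 0) such that $Z$ is, up to a null set, a union of elements of $\mathcal P''$, and a map $\tilde\tau:Z\to\{1,2,\dots\}$ constant on the elements of $\mathcal P''$ contained in $Z$, such that (a) $\tilde G=T^{\tilde\tau}$ is a full-branched Gibbs–Markov map of $Z$: it maps each element $W\subset Z$ of $\mathcal P''$ homeomorphically and non-singularly onto $Z$, and there are $\tilde\lambda\in(0,1)$, $\tilde\alpha\in(0,1]$, $\tilde D\ge0$ such that for every such $W$ the inverse $g:Z\to W$ of $\tilde G|_W$ satisfies $\operatorname{dist}(g(x),g(y))\le\tilde\lambda\operatorname{dist}(x,y)$ and $Jg(x)\le e^{\tilde D\operatorname{dist}(x,y)^{\tilde\alpha}}Jg(y)$ for all $x,y\in Z$; (b) there are $C<\infty$ and $\tilde\kappa\in(0,1)$ with $m(\tilde\tau>n)\le C\tilde\kappa^n$ for all $n\ge0$. Then there is a non-empty open set $Z\subset X$ on which $T$ has a full-branched Gibbs–Markov inducing scheme with exponential tails. Moreover, for every open set $U\subset\mathbb R^d$ such that the set of points of $X\cap U$ whose orbit visits $U$ infinitely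 often has positive Lebesgue measure (if $T$ is conservative, this is every open $U$ with $m(U\cap X)>0$), the set $Z$ can be chosen to be an open cube contained in $U\cap X$. -/

import Mathlib

open Set Filter Topology MeasureTheory
open scoped ENNReal

namespace PiecewiseExpanding

/-- Euclidean space `ℝ^d` with its Euclidean distance and Lebesgue measure `volume`. -/
abbrev Space (d : ℕ) : Type := EuclideanSpace ℝ (Fin d)

/-- The inner `ε`-boundary `∂_ε A = {x ∈ A : dist (x, ∂A) < ε}`, where `∂A` is the topological
boundary of `A` in `ℝ^d`. -/
def innerBoundary {d : ℕ} (ε : ℝ) (A : Set (Space d)) : Set (Space d) :=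
  A ∩ Metric.thickening ε (frontier A)

/-- The condition `sup_{ε > 0} Leb (∂_ε X) / ε < ∞`. -/
def HasRegularBoundary {d : ℕ} (X : Set (Space d)) : Prop :=
  ∃ C : ℝ, ∀ ε : ℝ, 0 < ε → volume (innerBoundary ε X) ≤ ENNReal.ofReal (C * ε)

/-- `P` is a countable (mod 0)-partition of `X` into nonempty open subsets of `X`. -/
structure IsOpenPartition {d : ℕ} (X : Set (Space d)) (P : Set (Set (Space d))) : Prop where
  countable : P.Countable
  isOpen : ∀ O ∈ P, IsOpen O
  nonempty : ∀ O ∈ P, O.Nonempty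
  subset : ∀ O ∈ P, O ⊆ X
  disjoint : P.PairwiseDisjoint id
  cover : volume (X \ ⋃₀ P) = 0

/-- `T` is a non-singular piecewise invertible map of `X` with respect to the partition `P`: every
`O ∈ P` is mapped homeomorphically onto an (open) subset `T(O)` of `X`, and the image under
`T|_O` of Lebesgue measure on `O` is equivalent to Lebesgue measure on `T(O)`.
(For a homeomorphism of an open subset of `ℝ^d` onto a subset of `ℝ^d`, openness of the image is
automatic, by invariance of domain.) -/
structure IsPiecewiseInvertible {d : ℕ} (T : Space d → Space d) (X : Set (Space d))
    (P : Set (Set (Space d))) : Prop where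
  partition : IsOpenPartition X P
  mapsTo : ∀ O ∈ P, MapsTo T O X
  homeo : ∀ O ∈ P, IsOpenEmbedding (O.domRestrict T)
  nonsingular : ∀ O ∈ P, ∀ A : Set (Space d), MeasurableSet A → A ⊆ T '' O →
    (volume (O ∩ T ⁻¹' A) = 0 ↔ volume A = 0)

/-- Uniform expansion: each inverse branch `h : T(O) → O` contracts by the factor `lam` all
distances between points at distance at most `ε` from each other. -/
def UniformExpansion {d : ℕ} (T : Space d → Space d) (P : Set (Set (Space d)))
    (lam ε : ℝ) : Prop :=
  ∀ O ∈ P, ∀ x ∈ O, ∀ y ∈ O, dist (T x) (T y) ≤ ε → dist x y ≤ lam * dist (T x) (T y)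

/-- `J` is (a version of) the Radon-Nikodym derivative `Jh = d(Leb ∘ h) / dLeb` on `T(O)`, where
`h : T(O) → O` is the inverse of `T|_O`; note that `h(A) = O ∩ T⁻¹(A)` for `A ⊆ T(O)`. -/
def IsInverseJacobian {d : ℕ} (T : Space d → Space d) (O : Set (Space d))
    (J : Space d → ℝ≥0∞) : Prop :=
  Measurable J ∧ ∀ A : Set (Space d), MeasurableSet A → A ⊆ T '' O →
    volume (O ∩ T ⁻¹' A) = ∫⁻ y in A, J y

/-- Bounded distortion: `Jh(x) ≤ exp (D * dist(x, y)^α) * Jh(y)` on `T(O)`, for every inverse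
branch `h : T(O) → O`. -/
def BoundedDistortion {d : ℕ} (T : Space d → Space d) (P : Set (Set (Space d)))
    (α D : ℝ) : Prop :=
  ∀ O ∈ P, ∃ J : Space d → ℝ≥0∞, IsInverseJacobian T O J ∧
    ∀ x ∈ T '' O, ∀ y ∈ T '' O, J x ≤ ENNReal.ofReal (Real.exp (D * dist x y ^ α)) * J y

/-- The set of points whose itinerary for `T` at the times `0, …, n - 1` is `w`. The nonempty sets
of this form, with `w` a word in the elements of `P`, are the elements of the partition `P^n`;
they are the ranges of the inverse branches of `T^n`. -/
def cylinder {d n : ℕ} (T : Space d → Space d) {P : Set (Set (Space d))} (w : Fin n → P) :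
    Set (Space d) :=
  {x | ∀ i : Fin n, T^[(i : ℕ)] x ∈ (w i : Set (Space d))}

/-- The complexity expression of `T^n` on `I` at scale `ε`: the sum, over the inverse branches `h`
of `T^n` with `Leb (I ∩ O_h) > 0`, of
`Leb (h(∂_ε T^n(I ∩ O_h)) \ ∂_{lam^n ε} I) / Leb (∂_{lam^n ε} I)`. -/
noncomputable def complexity {d : ℕ} (T : Space d → Space d) (P : Set (Set (Space d)))
    (lam : ℝ) (n : ℕ) (I : Set (Space d)) (ε : ℝ) : ℝ≥0∞ :=
  ∑' w : {w : Fin n → P // 0 < volume (I ∩ cylinder T w)},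
    volume ((cylinder T w.1 ∩ T^[n] ⁻¹' innerBoundary ε (T^[n] '' (I ∩ cylinder T w.1)))
        \ innerBoundary (lam ^ n * ε) I)
      / volume (innerBoundary (lam ^ n * ε) I)

/-- Controlled complexity, with the expansion constant `lam`, the time `n₀`, the scale `ε₀` and
the bound `σ`. -/
def ControlledComplexity {d : ℕ} (T : Space d → Space d) (X : Set (Space d))
    (P : Set (Set (Space d))) (lam : ℝ) (n₀ : ℕ) (ε₀ σ : ℝ) : Prop :=
  0 < ε₀ ∧ 0 ≤ σ ∧ σ < (lam ^ n₀)⁻¹ - 1 ∧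
  (∀ I : Set (Space d), IsOpen I → I ⊆ X → Metric.diam I ≤ ε₀ → ∀ ε : ℝ, 0 < ε → ε < ε₀ →
    complexity T P lam n₀ I ε ≤ ENNReal.ofReal σ) ∧
  ∃ C : ℝ, ∀ r : ℕ, 1 ≤ r → r < n₀ →
    ∀ I : Set (Space d), IsOpen I → I ⊆ X → Metric.diam I ≤ ε₀ → ∀ ε : ℝ, 0 < ε → ε < ε₀ →
      complexity T P lam r I ε ≤ ENNReal.ofReal C

/-- `G` is a full-branched Gibbs-Markov map of `Z` with respect to the partition `P` of `Z`: a
non-singular piecewise invertible map with uniform expansion (at all scales) and bounded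
distortion, which maps every element of `P` onto `Z`. -/
def IsFullBranchedGibbsMarkov {d : ℕ} (G : Space d → Space d) (Z : Set (Space d))
    (P : Set (Set (Space d))) : Prop :=
  IsPiecewiseInvertible G Z P ∧
  (∀ W ∈ P, G '' W = Z) ∧
  (∃ lam : ℝ, 0 < lam ∧ lam < 1 ∧ ∀ ε : ℝ, UniformExpansion G P lam ε) ∧
  ∃ α D : ℝ, 0 < α ∧ α ≤ 1 ∧ 0 ≤ D ∧ BoundedDistortion G P α D

/-- There are a refinement `Q` of `P` into open sets (mod 0), of whose elements `Z` is a union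
(mod 0), and a return time `τ ≥ 1` on `Z` that is constant on the elements of `Q` in `Z`, such
that `T^τ : Z → Z` is a full-branched Gibbs-Markov map and `τ` has exponential tails.
That the elements of `Q` in `Z` exhaust `Z` up to a null set is part of
`IsFullBranchedGibbsMarkov`. -/
def HasFullBranchedInducingScheme {d : ℕ} (T : Space d → Space d) (X : Set (Space d))
    (P : Set (Set (Space d))) (Z : Set (Space d)) : Prop :=
  ∃ (Q : Set (Set (Space d))) (τ : Space d → ℕ),
    IsOpenPartition X Q ∧
    (∀ W ∈ Q, ∃ O ∈ P, W ⊆ O) ∧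
    (∀ x ∈ Z, 1 ≤ τ x) ∧
    (∀ W ∈ Q, W ⊆ Z → ∀ x ∈ W, ∀ y ∈ W, τ x = τ y) ∧
    IsFullBranchedGibbsMarkov (fun x => T^[τ x] x) Z {W ∈ Q | W ⊆ Z} ∧
    ∃ C κ : ℝ, 0 < κ ∧ κ < 1 ∧
      ∀ n : ℕ, volume {x ∈ Z | n < τ x} ≤ ENNReal.ofReal (C * κ ^ n)

/-- The open cube with centre `a` and side length `2 * r`, with sides parallel to the axes. -/
def openCube {d : ℕ} (a : Space d) (r : ℝ) : Set (Space d) :=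
  {x | ∀ i, |x i - a i| < r}

/-- The points of `X ∩ U` whose orbit visits `U` infinitely often. -/
def recurrentPart {d : ℕ} (T : Space d → Space d) (X U : Set (Space d)) : Set (Space d) :=
  {x ∈ X ∩ U | ∃ᶠ n : ℕ in atTop, T^[n] x ∈ U}

end PiecewiseExpanding

namespace PiecewiseExpanding

/-! The proof is a competition between expansion and cutting. The fragmentation of a countable
family of branch pieces is measured by its boundary mass at scale ε: the total mass of the points
whose image lies in the inner ε-boundary of the image of their piece. Applying T^n₀ pulls the scale
ε back to λ^n₀ ε, while controlled complexity limits the effect of the new cuts to a factor 1 + σ.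
The images are also cut into cells of diameter at most ℓ, with walls chosen by a maximal inequality
so that their ε-neighbourhoods carry mass O(ε) (`exists_cells`, `exists_hasStep`). A bound Bε on the
boundary mass thus becomes (θB + bKm)ε, where m is the mass, b is the distortion factor on images of
diameter at most ℓ, and θ = b(1 + σ)λ^n₀. For small ℓ, θ < 1. Under iteration, at least half of the
mass of a small ball then sits in pieces at points whose image is δ-far from the boundary
(`exists_iterated_step`, `measure_frequently_reaches_pos`).

Fix finitely many small balls with regular boundary, the templates, so that the δ-ball around any
point of X contains one of them through that point. Every open set reaches templates, and does so
infinitely often on a set of positive measure. A minimality argument over the finite set of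
templates, combined with ergodicity, yields one template reached by every open set
(`exists_common_template`), and from it a cube Z in U ∩ X reached by every open set
(`exists_target_cube`).

Now induce. An image with a point δ-far from its boundary contains a template, hence a set R sent
onto Z in bounded time and carrying a definite share of the mass. Removing R creates extra boundary
mass, but at most a multiple of ε times the mass of R (`exists_return_decomposition`,
`exists_inducing_step`). Writing M for the remaining mass, the quantity M + ηB contracts by a fixed
factor at each step: either much mass returns, or M is dominated by B, and B itself contracts
(`exists_contracting_potential`, `exists_inducing_families`). The times of each step are bounded, so
this is exponential decay in time, and the branches R → Z pulled back to Z form the inducing scheme.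
-/

variable {d : ℕ} {T : Space d → Space d} {X : Set (Space d)} {P : Set (Set (Space d))}
  {lam ε₁ α D : ℝ}

/-! ### Branches of the iterates of T -/

/-- A non-singular piecewise invertible map with uniform expansion and bounded distortion. -/
structure IsExpandingSystem (T : Space d → Space d) (X : Set (Space d)) (P : Set (Set (Space d)))
    (lam ε₁ α D : ℝ) : Prop where
  bounded : Bornology.IsBounded X
  measurableSet : MeasurableSet X
  invertible : IsPiecewiseInvertible T X P
  quasi : Measure.QuasiMeasurePreserving T (volume.restrict X) (volume.restrict X)
  lam_pos : 0 < lam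
  lam_lt_one : lam < 1
  scale_pos : 0 < ε₁
  expansion : UniformExpansion T P lam ε₁
  exponent_pos : 0 < α
  distortion_nonneg : 0 ≤ D
  distortion : BoundedDistortion T P α D

/-- `W` is an open set on which the itinerary of length `n` is well defined and constant. -/
structure IsBranchDomain (T : Space d → Space d) (P : Set (Set (Space d))) (n : ℕ)
    (W : Set (Space d)) : Prop where
  isOpen : IsOpen W
  itinerary : ∀ i < n, ∃ O ∈ P, MapsTo T^[i] W O

theorem isBranchDomain_zero {W : Set (Space d)} (hW : IsOpen W) : IsBranchDomain T P 0 W :=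
  ⟨hW, fun _ hi => absurd hi (Nat.not_lt_zero _)⟩

namespace IsBranchDomain

theorem mono {n : ℕ} {V W : Set (Space d)} (h : IsBranchDomain T P n W) (hV : IsOpen V)
    (hVW : V ⊆ W) : IsBranchDomain T P n V :=
  ⟨hV, fun i hi => let ⟨O, hO, hm⟩ := h.itinerary i hi; ⟨O, hO, hm.mono_left hVW⟩⟩

theorem exists_subset {n : ℕ} {W : Set (Space d)} (h : IsBranchDomain T P n W) (hn : 1 ≤ n) :
    ∃ O ∈ P, W ⊆ O := by
  obtain ⟨O, hO, hm⟩ := h.itinerary 0 hn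
  exact ⟨O, hO, fun x hx => hm hx⟩

theorem of_le {m n : ℕ} {W : Set (Space d)} (h : IsBranchDomain T P n W) (hmn : m ≤ n) :
    IsBranchDomain T P m W :=
  ⟨h.isOpen, fun i hi => h.itinerary i (hi.trans_le hmn)⟩

end IsBranchDomain

namespace IsExpandingSystem

theorem measurable (hS : IsExpandingSystem T X P lam ε₁ α D) : Measurable T :=
  hS.quasi.measurable

theorem measurable_iterate (hS : IsExpandingSystem T X P lam ε₁ α D) (n : ℕ) :
    Measurable T^[n] :=
  hS.measurable.iterate n

theorem volume_lt_top (hS : IsExpandingSystem T X P lam ε₁ α D) : volume X < ∞ :=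
  hS.bounded.measure_lt_top

/-- Almost every point of `X` has an infinite itinerary. -/
theorem ae_iterate_mem (hS : IsExpandingSystem T X P lam ε₁ α D) :
    ∀ᵐ x ∂volume.restrict X, ∀ n, T^[n] x ∈ ⋃₀ P := by
  have h0 : ∀ᵐ x ∂volume.restrict X, x ∈ ⋃₀ P := by
    rw [ae_restrict_iff' hS.measurableSet, ae_iff]
    refine measure_mono_null (fun x hx => ?_) hS.invertible.partition.cover
    simp only [mem_ofPred_eq, Classical.not_imp] at hx
    exact hx
  rw [ae_all_iff]
  intro n
  exact (hS.quasi.iterate n).ae h0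

theorem isOpen_image_of_mem (hS : IsExpandingSystem T X P lam ε₁ α D) {O V : Set (Space d)}
    (hO : O ∈ P) (hV : IsOpen V) (hVO : V ⊆ O) : IsOpen (T '' V) := by
  have h := (hS.invertible.homeo O hO).isOpenMap _ (hV.preimage continuous_subtype_val)
  convert h using 1
  ext y
  constructor
  · rintro ⟨x, hx, rfl⟩
    exact ⟨⟨x, hVO hx⟩, hx, rfl⟩
  · rintro ⟨x, hx, rfl⟩
    exact ⟨x, hx, rfl⟩

theorem continuousOn_of_mem (hS : IsExpandingSystem T X P lam ε₁ α D) {O : Set (Space d)}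
    (hO : O ∈ P) : ContinuousOn T O :=
  continuousOn_iff_continuous_domRestrict.2 (hS.invertible.homeo O hO).continuous

theorem injOn_of_mem (hS : IsExpandingSystem T X P lam ε₁ α D) {O : Set (Space d)}
    (hO : O ∈ P) : InjOn T O :=
  injOn_iff_injective.2 (hS.invertible.homeo O hO).injective

end IsExpandingSystem

namespace IsBranchDomain

/-- Inductions on the order of a branch peel off the first iterate by means of this lemma, so that
one-step hypotheses on elements of `P` suffice. -/
theorem image (hS : IsExpandingSystem T X P lam ε₁ α D) {n : ℕ} {W : Set (Space d)}
    (h : IsBranchDomain T P (n + 1) W) : IsBranchDomain T P n (T '' W) := by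
  obtain ⟨O, hO, hWO⟩ := h.exists_subset (Nat.le_add_left 1 n)
  refine ⟨hS.isOpen_image_of_mem hO h.isOpen hWO, fun i hi => ?_⟩
  obtain ⟨O', hO', hm⟩ := h.itinerary (i + 1) (Nat.succ_lt_succ hi)
  refine ⟨O', hO', ?_⟩
  rintro _ ⟨x, hx, rfl⟩
  exact hm hx

theorem continuousOn (hS : IsExpandingSystem T X P lam ε₁ α D) {n : ℕ} {W : Set (Space d)}
    (h : IsBranchDomain T P n W) : ContinuousOn T^[n] W := by
  induction n generalizing W with
  | zero => exact continuousOn_id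
  | succ n ih =>
    obtain ⟨O, hO, hWO⟩ := h.exists_subset (Nat.le_add_left 1 n)
    exact (ih (h.image hS)).comp ((hS.continuousOn_of_mem hO).mono hWO) (mapsTo_image T W)

theorem injOn (hS : IsExpandingSystem T X P lam ε₁ α D) {n : ℕ} {W : Set (Space d)}
    (h : IsBranchDomain T P n W) : InjOn T^[n] W := by
  induction n generalizing W with
  | zero => exact injOn_id W
  | succ n ih =>
    obtain ⟨O, hO, hWO⟩ := h.exists_subset (Nat.le_add_left 1 n)
    exact (ih (h.image hS)).comp ((hS.injOn_of_mem hO).mono hWO) (mapsTo_image T W)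

theorem isOpen_image (hS : IsExpandingSystem T X P lam ε₁ α D) {n : ℕ} {W : Set (Space d)}
    (h : IsBranchDomain T P n W) : IsOpen (T^[n] '' W) := by
  induction n generalizing W with
  | zero => simpa using h.isOpen
  | succ n ih =>
    have := ih (h.image hS)
    rwa [← image_comp] at this

theorem isOpen_inter_preimage (hS : IsExpandingSystem T X P lam ε₁ α D) {n : ℕ}
    {V W : Set (Space d)} (h : IsBranchDomain T P n W) (hV : IsOpen V) :
    IsOpen (W ∩ T^[n] ⁻¹' V) :=
  (h.continuousOn hS).isOpen_inter_preimage h.isOpen hV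

theorem inter_preimage (hS : IsExpandingSystem T X P lam ε₁ α D) {n : ℕ}
    {V W : Set (Space d)} (h : IsBranchDomain T P n W) (hV : IsOpen V) :
    IsBranchDomain T P n (W ∩ T^[n] ⁻¹' V) :=
  h.mono (h.isOpen_inter_preimage hS hV) inter_subset_left

theorem isOpenEmbedding (hS : IsExpandingSystem T X P lam ε₁ α D) {n : ℕ} {W : Set (Space d)}
    (h : IsBranchDomain T P n W) : IsOpenEmbedding (W.domRestrict T^[n]) := by
  refine .of_continuous_injective_isOpenMap
    (continuousOn_iff_continuous_domRestrict.1 (h.continuousOn hS))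
    (injOn_iff_injective.1 (h.injOn hS)) fun U hU => ?_
  have hU' : IsOpen ((↑) '' U : Set (Space d)) := h.isOpen.isOpenMap_subtype_val U hU
  have := (h.mono hU' (by rintro _ ⟨x, _, rfl⟩; exact x.2)).isOpen_image hS
  rwa [← image_comp] at this

theorem comp (hS : IsExpandingSystem T X P lam ε₁ α D) {m n : ℕ} {V W : Set (Space d)}
    (hW : IsBranchDomain T P n W) (hV : IsBranchDomain T P m V) :
    IsBranchDomain T P (n + m) (W ∩ T^[n] ⁻¹' V) := by
  refine ⟨hW.isOpen_inter_preimage hS hV.isOpen, fun i hi => ?_⟩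
  rcases lt_or_ge i n with hin | hin
  · obtain ⟨O, hO, hm⟩ := hW.itinerary i hin
    exact ⟨O, hO, hm.mono_left inter_subset_left⟩
  · obtain ⟨O, hO, hm⟩ := hV.itinerary (i - n) (by omega)
    refine ⟨O, hO, fun x hx => ?_⟩
    have := hm hx.2
    rwa [← Function.iterate_add_apply, Nat.sub_add_cancel hin] at this

theorem image_subset (hS : IsExpandingSystem T X P lam ε₁ α D) {n : ℕ} {W : Set (Space d)}
    (h : IsBranchDomain T P n W) (hWX : W ⊆ X) : T^[n] '' W ⊆ X := by
  cases n with
  | zero => simpa using hWX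
  | succ n =>
    obtain ⟨O, hO, hm⟩ := h.itinerary n n.lt_succ_self
    rintro _ ⟨x, hx, rfl⟩
    rw [Function.iterate_succ_apply']
    exact hS.invertible.mapsTo O hO (hm hx)

/-- Contraction is only assumed at distances below ε₁. It suffices to have this at the final time,
because contraction passes the bound back to all earlier times. -/
theorem dist_le (hS : IsExpandingSystem T X P lam ε₁ α D) {n : ℕ} {W : Set (Space d)}
    (h : IsBranchDomain T P n W) {x y : Space d} (hx : x ∈ W) (hy : y ∈ W)
    (hxy : dist (T^[n] x) (T^[n] y) ≤ ε₁) :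
    dist x y ≤ lam ^ n * dist (T^[n] x) (T^[n] y) := by
  induction n generalizing W x y with
  | zero => simp
  | succ n ih =>
    obtain ⟨O, hO, hWO⟩ := h.exists_subset (Nat.le_add_left 1 n)
    have h1 := ih (h.image hS) (mem_image_of_mem T hx) (mem_image_of_mem T hy) hxy
    rw [← Function.iterate_succ_apply, ← Function.iterate_succ_apply] at h1
    have h2 : lam ^ n * dist (T^[n + 1] x) (T^[n + 1] y) ≤ dist (T^[n + 1] x) (T^[n + 1] y) :=
      mul_le_of_le_one_left dist_nonneg (pow_le_one₀ hS.lam_pos.le hS.lam_lt_one.le)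
    have h3 := hS.expansion O hO x (hWO hx) y (hWO hy) ((h1.trans h2).trans hxy)
    calc dist x y ≤ lam * dist (T x) (T y) := h3
      _ ≤ lam * (lam ^ n * dist (T^[n + 1] x) (T^[n + 1] y)) :=
        mul_le_mul_of_nonneg_left h1 hS.lam_pos.le
      _ = _ := by ring

/-! ### Distortion of iterated inverse branches -/

/-- The map `T^n` on a branch domain of order `n` has an inverse Jacobian, with bounded
distortion as long as the image is small. -/
theorem exists_jacobian_sum (hS : IsExpandingSystem T X P lam ε₁ α D) {n : ℕ}
    {W : Set (Space d)} (h : IsBranchDomain T P n W)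
    (hdiam : ∀ x ∈ W, ∀ y ∈ W, dist (T^[n] x) (T^[n] y) ≤ ε₁) :
    ∃ J : Space d → ℝ≥0∞, IsInverseJacobian T^[n] W J ∧
      ∀ x ∈ T^[n] '' W, ∀ y ∈ T^[n] '' W,
        J x ≤ ENNReal.ofReal (Real.exp (D * (∑ i ∈ Finset.range n, (lam ^ α) ^ i) *
          dist x y ^ α)) * J y := by
  induction n generalizing W with
  | zero =>
    refine ⟨fun _ => 1, ⟨measurable_const, fun A _ hA => ?_⟩, fun x _ y _ => by simp⟩
    simp only [Function.iterate_zero, image_id, preimage_id] at hA ⊢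
    rw [lintegral_one, inter_eq_right.2 hA, Measure.restrict_apply_univ]
  | succ n ih =>
    have hW1 := h.image hS
    obtain ⟨O, hO, hWO⟩ := h.exists_subset (Nat.le_add_left 1 n)
    obtain ⟨Jn, ⟨hJnm, hJn⟩, hJnd⟩ := ih hW1 (by
      rintro _ ⟨x, hx, rfl⟩ _ ⟨y, hy, rfl⟩
      exact hdiam x hx y hy)
    obtain ⟨J1, ⟨hJ1m, hJ1⟩, hJ1d⟩ := hS.distortion O hO
    set W1 := T '' W with hW1def
    have himg : T^[n + 1] '' W = T^[n] '' W1 := by rw [hW1def, ← image_comp]; rfl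
    have hemb := hW1.isOpenEmbedding hS
    have hmemb : MeasurableEmbedding (W1.domRestrict T^[n]) :=
      hemb.measurableEmbedding
    -- The chain rule multiplies `Jn` at the endpoint by `J1` at the intermediate point.
    -- Transporting `J1` by the injective map T^n on `W1` makes it a measurable function of the
    -- endpoint.
    let G : Space d → ℝ≥0∞ := Function.extend (W1.domRestrict T^[n]) (fun x => J1 x) 0
    have hGm : Measurable G :=
      hmemb.measurable_extend (hJ1m.comp measurable_subtype_coe) measurable_const
    have hG : ∀ x ∈ W1, G (T^[n] x) = J1 x := fun x hx =>
      hemb.injective.extend_apply (fun x : W1 => J1 x) 0 ⟨x, hx⟩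
    have hmap : (volume.restrict W1).map T^[n] =
        (volume.restrict (T^[n] '' W1)).withDensity Jn := by
      ext A hA
      have hI := (hW1.isOpen_image hS).measurableSet
      rw [Measure.map_apply (hS.measurable_iterate n) hA,
        Measure.restrict_apply (hS.measurable_iterate n hA), withDensity_apply _ hA,
        Measure.restrict_restrict hA, ← hJn _ (hA.inter hI) inter_subset_right]
      congr 1
      ext x
      simp only [mem_inter_iff, mem_preimage]
      exact ⟨fun hx => ⟨hx.2, hx.1, mem_image_of_mem _ hx.2⟩, fun hx => ⟨hx.2.1, hx.1⟩⟩
    refine ⟨fun y => Jn y * G y, ⟨hJnm.mul hGm, fun A hA hAI => ?_⟩, ?_⟩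
    · rw [himg] at hAI
      have hTA := hS.measurable_iterate n hA
      have e1 : W ∩ T^[n + 1] ⁻¹' A = O ∩ T ⁻¹' (W1 ∩ T^[n] ⁻¹' A) := by
        ext x
        simp only [mem_inter_iff, mem_preimage, Function.iterate_succ_apply]
        constructor
        · rintro ⟨hx, hx'⟩
          exact ⟨hWO hx, mem_image_of_mem _ hx, hx'⟩
        · rintro ⟨hx, ⟨x', hx', he⟩, hA⟩
          exact ⟨hS.injOn_of_mem hO (hWO hx') hx he ▸ hx', hA⟩
      rw [e1, hJ1 _ (hW1.isOpen.measurableSet.inter hTA)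
        (inter_subset_left.trans (image_mono hWO))]
      have e2 : ∫⁻ y in W1 ∩ T^[n] ⁻¹' A, J1 y = ∫⁻ y in W1 ∩ T^[n] ⁻¹' A, G (T^[n] y) :=
        setLIntegral_congr_fun (hW1.isOpen.measurableSet.inter hTA) fun y hy => (hG y hy.1).symm
      rw [e2, inter_comm, ← Measure.restrict_restrict hTA,
        ← setLIntegral_map hA hGm (hS.measurable_iterate n), hmap,
        restrict_withDensity hA, lintegral_withDensity_eq_lintegral_mul _ hJnm hGm,
        Measure.restrict_restrict hA, inter_eq_left.2 hAI]
      rfl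
    · rw [himg]
      rintro _ ⟨x, hx, rfl⟩ _ ⟨y, hy, rfl⟩
      have hd : dist (T^[n] x) (T^[n] y) ≤ ε₁ := by
        obtain ⟨x, hx, rfl⟩ := hx
        obtain ⟨y, hy, rfl⟩ := hy
        exact hdiam x hx y hy
      have h1 := hJnd _ (mem_image_of_mem _ hx) _ (mem_image_of_mem _ hy)
      have h2 := hJ1d x (image_mono hWO hx) y (image_mono hWO hy)
      -- The contraction over the last n iterates supplies the next term of the geometric series in
      -- λ^α.
      have h3 : dist x y ^ α ≤ (lam ^ α) ^ n * dist (T^[n] x) (T^[n] y) ^ α := by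
        calc dist x y ^ α ≤ (lam ^ n * dist (T^[n] x) (T^[n] y)) ^ α :=
              Real.rpow_le_rpow dist_nonneg (hW1.dist_le hS hx hy hd) hS.exponent_pos.le
          _ = _ := by
            rw [Real.mul_rpow (pow_nonneg hS.lam_pos.le n) dist_nonneg,
              ← Real.rpow_natCast, ← Real.rpow_natCast, ← Real.rpow_mul hS.lam_pos.le,
              ← Real.rpow_mul hS.lam_pos.le, mul_comm α]
      simp only [hG x hx, hG y hy]
      calc Jn (T^[n] x) * J1 x
          ≤ (ENNReal.ofReal (Real.exp (D * (∑ i ∈ Finset.range n, (lam ^ α) ^ i) *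
              dist (T^[n] x) (T^[n] y) ^ α)) * Jn (T^[n] y)) *
            (ENNReal.ofReal (Real.exp (D * dist x y ^ α)) * J1 y) := mul_le_mul' h1 h2
        _ = ENNReal.ofReal (Real.exp (D * (∑ i ∈ Finset.range n, (lam ^ α) ^ i) *
              dist (T^[n] x) (T^[n] y) ^ α + D * dist x y ^ α)) *
              (Jn (T^[n] y) * J1 y) := by
            rw [Real.exp_add, ENNReal.ofReal_mul (Real.exp_pos _).le]
            ring
        _ ≤ _ := by
            gcongr
            rw [Finset.sum_range_succ]
            nlinarith [mul_le_mul_of_nonneg_left h3 hS.distortion_nonneg]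

end IsBranchDomain

/-- The distortion constant of the iterates of the inverse branches. -/
noncomputable def iteratedDistortion (lam α D : ℝ) : ℝ := D * (1 - lam ^ α)⁻¹

/-- The distortion factor of the iterated inverse branches on sets of diameter at most `ℓ`. -/
noncomputable def distortionFactor (lam α D ℓ : ℝ) : ℝ :=
  Real.exp (2 * (iteratedDistortion lam α D * ℓ ^ α))

theorem distortionFactor_pos (lam α D ℓ : ℝ) : 0 < distortionFactor lam α D ℓ :=
  Real.exp_pos _

theorem IsExpandingSystem.iteratedDistortion_nonneg (hS : IsExpandingSystem T X P lam ε₁ α D) :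
    0 ≤ iteratedDistortion lam α D :=
  mul_nonneg hS.distortion_nonneg (inv_nonneg.2 (sub_nonneg.2
    (Real.rpow_le_one hS.lam_pos.le hS.lam_lt_one.le hS.exponent_pos.le)))

namespace IsBranchDomain

theorem exists_jacobian (hS : IsExpandingSystem T X P lam ε₁ α D) {n : ℕ}
    {W : Set (Space d)} (h : IsBranchDomain T P n W)
    (hdiam : ∀ x ∈ W, ∀ y ∈ W, dist (T^[n] x) (T^[n] y) ≤ ε₁) :
    ∃ J : Space d → ℝ≥0∞, IsInverseJacobian T^[n] W J ∧
      ∀ x ∈ T^[n] '' W, ∀ y ∈ T^[n] '' W,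
        J x ≤ ENNReal.ofReal (Real.exp (iteratedDistortion lam α D * dist x y ^ α)) * J y := by
  obtain ⟨J, hJ, hJd⟩ := h.exists_jacobian_sum hS hdiam
  refine ⟨J, hJ, fun x hx y hy => (hJd x hx y hy).trans ?_⟩
  gcongr
  refine mul_le_mul_of_nonneg_left ?_ hS.distortion_nonneg
  have h0 : 0 ≤ lam ^ α := Real.rpow_nonneg hS.lam_pos.le α
  have h1 : lam ^ α < 1 := Real.rpow_lt_one hS.lam_pos.le hS.lam_lt_one hS.exponent_pos
  rw [← tsum_geometric_of_lt_one h0 h1]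
  exact (summable_geometric_of_lt_one h0 h1).sum_le_tsum _ fun i _ => pow_nonneg h0 i

/-- On branches with small image, the measure `A ↦ volume (W ∩ T⁻ⁿ A)` is comparable to a multiple
of Lebesgue measure. -/
theorem exists_comparison (hS : IsExpandingSystem T X P lam ε₁ α D) {n : ℕ}
    {W : Set (Space d)} (h : IsBranchDomain T P n W) (hWX : W ⊆ X) {ℓ : ℝ} (hℓ : ℓ ≤ ε₁)
    (hdiam : Metric.diam (T^[n] '' W) ≤ ℓ) :
    ∃ κ : ℝ≥0∞, κ ≠ 0 ∧ κ ≠ ∞ ∧ ∀ A : Set (Space d), MeasurableSet A → A ⊆ T^[n] '' W →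
      κ * volume A ≤ volume (W ∩ T^[n] ⁻¹' A) ∧
      volume (W ∩ T^[n] ⁻¹' A) ≤
        ENNReal.ofReal (distortionFactor lam α D ℓ) * (κ * volume A) := by
  have hI := h.isOpen_image hS
  rcases W.eq_empty_or_nonempty with rfl | ⟨w, hw⟩
  · refine ⟨1, one_ne_zero, ENNReal.one_ne_top, fun A _ hA => ?_⟩
    simp only [image_empty, subset_empty_iff] at hA
    simp [hA]
  have hbd := hS.bounded.subset (h.image_subset hS hWX)
  have hdist : ∀ x ∈ T^[n] '' W, ∀ y ∈ T^[n] '' W, dist x y ≤ ℓ := fun x hx y hy =>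
    (Metric.dist_le_diam_of_mem hbd hx hy).trans hdiam
  obtain ⟨J, ⟨-, hJ⟩, hJd⟩ := h.exists_jacobian hS fun x hx y hy =>
    (hdist _ (mem_image_of_mem _ hx) _ (mem_image_of_mem _ hy)).trans hℓ
  set K := iteratedDistortion lam α D * ℓ ^ α
  have hJK : ∀ x ∈ T^[n] '' W, ∀ y ∈ T^[n] '' W, J x ≤ ENNReal.ofReal (Real.exp K) * J y := by
    intro x hx y hy
    refine (hJd x hx y hy).trans ?_
    gcongr
    exact mul_le_mul_of_nonneg_left (Real.rpow_le_rpow dist_nonneg (hdist x hx y hy)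
      hS.exponent_pos.le) hS.iteratedDistortion_nonneg
  have hy₀ : T^[n] w ∈ T^[n] '' W := mem_image_of_mem _ hw
  set y₀ := T^[n] w
  have hW : volume W = ∫⁻ y in T^[n] '' W, J y := by
    rw [← hJ _ hI.measurableSet subset_rfl, inter_eq_left.2 (subset_preimage_image _ _)]
  have hWpos : volume W ≠ 0 := (h.isOpen.measure_pos _ ⟨w, hw⟩).ne'
  have hIpos : volume (T^[n] '' W) ≠ 0 := (hI.measure_pos _ ⟨y₀, hy₀⟩).ne'
  have hJ0 : J y₀ ≠ 0 := by
    intro h0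
    apply hWpos
    rw [hW, setLIntegral_congr_fun (g := 0) hI.measurableSet]
    · simp
    · intro y hy
      simpa [h0] using hJK y hy y₀ hy₀
  have hJtop : J y₀ ≠ ∞ := by
    intro h0
    have : ∞ ≤ volume W := by
      rw [hW, setLIntegral_congr_fun (g := fun _ => ∞) hI.measurableSet]
      · rw [setLIntegral_const, ENNReal.top_mul hIpos]
      · intro y hy
        have := hJK y₀ hy₀ y hy
        rw [h0, top_le_iff, ENNReal.mul_eq_top] at this
        simp only [ENNReal.ofReal_ne_top, false_and, or_false] at this
        exact this.2
    exact absurd this (not_le.2 (hS.bounded.subset hWX).measure_lt_top)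
  have hexp : ENNReal.ofReal (Real.exp K) * ENNReal.ofReal (Real.exp (-K)) = 1 := by
    rw [← ENNReal.ofReal_mul (Real.exp_pos _).le, ← Real.exp_add]
    simp
  -- The value of J at one point determines J up to e^{±K}. Normalising the lower bound to 1 moves
  -- all of it into the upper bound, whence the factor 2 in `distortionFactor`.
  refine ⟨ENNReal.ofReal (Real.exp (-K)) * J y₀, mul_ne_zero ?_ hJ0,
    ENNReal.mul_ne_top ENNReal.ofReal_ne_top hJtop, fun A hA hAI => ?_⟩
  · simpa using Real.exp_pos (-K)
  rw [hJ A hA hAI, ← setLIntegral_const, ← lintegral_const_mul' _ _ ENNReal.ofReal_ne_top]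
  refine ⟨setLIntegral_mono' hA fun y hy => ?_, setLIntegral_mono' hA fun y hy => ?_⟩
  · calc ENNReal.ofReal (Real.exp (-K)) * J y₀
        ≤ ENNReal.ofReal (Real.exp (-K)) * (ENNReal.ofReal (Real.exp K) * J y) := by
          gcongr; exact hJK _ hy₀ _ (hAI hy)
      _ = J y := by rw [← mul_assoc, mul_comm (ENNReal.ofReal (Real.exp (-K))), hexp, one_mul]
  · calc J y ≤ ENNReal.ofReal (Real.exp K) * J y₀ := hJK _ (hAI hy) _ hy₀
      _ = ENNReal.ofReal (Real.exp (2 * K)) * (ENNReal.ofReal (Real.exp (-K)) * J y₀) := by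
        rw [← mul_assoc, ← ENNReal.ofReal_mul (Real.exp_pos _).le, ← Real.exp_add]
        congr 3
        ring

end IsBranchDomain

/-! ### Cutting a bounded set along walls of small mass -/

/-- A weak type maximal inequality gives levels `s` of a real function near which a finite measure
puts little mass, at all scales; moreover `s` may be chosen away from a given number `c`. -/
theorem exists_regular_level {Ω : Type*} [MeasurableSpace Ω] (ν : Measure Ω) [IsFiniteMeasure ν]
    {f : Ω → ℝ} (hf : Measurable f) {p q : ℝ} (hpq : p < q) (c : ℝ) :
    ∃ s ∈ Ioo p q, (q - p) / 8 < |s - c| ∧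
      ∀ ε > 0, ν {x | |f x - s| < ε} ≤ ENNReal.ofReal (40 / (q - p) * ε) * ν univ := by
  have hqp : 0 < q - p := sub_pos.2 hpq
  set K := 40 / (q - p) with hK
  have hKpos : 0 < K := by positivity
  rcases eq_or_ne (ν univ) 0 with hν | hν
  · have hlt : volume (Metric.closedBall c ((q - p) / 8)) < volume (Ioo p q) := by
      rw [Real.volume_closedBall, Real.volume_Ioo]
      exact (ENNReal.ofReal_lt_ofReal_iff hqp).2 (by linarith)
    obtain ⟨s, hs, hs'⟩ := not_subset.1 fun h => (measure_mono h).not_gt hlt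
    refine ⟨s, hs, by simpa [Real.dist_eq] using hs', fun ε _ => ?_⟩
    rw [hν, mul_zero]
    exact (measure_mono (subset_univ _)).trans_eq hν
  have hνtop : ν univ ≠ ∞ := measure_ne_top ν univ
  -- The balls carrying too much mass. Their radii are at most 1/K, as no ball has more than the
  -- total mass; this bound is what the Vitali covering lemma requires.
  let t : Set (ℝ × ℝ) := {b | 0 < b.2 ∧
    ENNReal.ofReal (K * b.2) * ν univ < ν (f ⁻¹' Metric.closedBall b.1 b.2)}
  have htR : ∀ b ∈ t, b.2 ≤ K⁻¹ := by
    rintro b ⟨hb0, hb⟩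
    by_contra! hlt
    have h1 : 1 ≤ K * b.2 := by
      have := mul_lt_mul_of_pos_left hlt hKpos
      rw [mul_inv_cancel₀ hKpos.ne'] at this
      exact this.le
    have h2 : ν univ ≤ ENNReal.ofReal (K * b.2) * ν univ := by
      conv_lhs => rw [← one_mul (ν univ)]
      gcongr
      simpa using ENNReal.ofReal_le_ofReal h1
    exact (h2.trans_lt hb).not_ge (measure_mono (subset_univ _))
  obtain ⟨u, hut, hudisj, hucov⟩ := Vitali.exists_disjoint_subfamily_covering_enlargement_closedBall
    t Prod.fst Prod.snd K⁻¹ htR 5 (by norm_num)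
  have hucount : u.Countable := hudisj.countable_of_nonempty_interior fun b hb => by
    rw [interior_closedBall _ (hut hb).1.ne']
    exact Metric.nonempty_ball.2 (hut hb).1
  have hsum : ∑' b : u, ENNReal.ofReal (K * b.1.2) ≤ 1 := by
    have h1 : (∑' b : u, ENNReal.ofReal (K * b.1.2)) * ν univ ≤ ν univ := by
      rw [← ENNReal.tsum_mul_right]
      calc ∑' b : u, ENNReal.ofReal (K * b.1.2) * ν univ
          ≤ ∑' b : u, ν (f ⁻¹' Metric.closedBall b.1.1 b.1.2) :=
            ENNReal.tsum_le_tsum fun b => (hut b.2).2.le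
        _ = ν (⋃ b ∈ u, f ⁻¹' Metric.closedBall b.1 b.2) := by
            rw [measure_biUnion hucount]
            · exact fun a ha b hb hab => (hudisj ha hb hab).preimage f
            · exact fun b _ => hf measurableSet_closedBall
        _ ≤ ν univ := measure_mono (subset_univ _)
    by_contra! hlt
    have := ENNReal.mul_lt_mul_left hν hνtop hlt
    rw [one_mul] at this
    exact this.not_ge h1
  let bad : Set ℝ := {s | ∃ ε > 0, ENNReal.ofReal (K * ε) * ν univ < ν {x | |f x - s| < ε}}
  -- The selected disjoint balls satisfy Σ K r ≤ 1, so their fivefold enlargements have total length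
  -- at most 10/K = (q - p)/4. The excluded neighbourhood of c has the same length, which leaves
  -- half of the interval.
  have hbad : volume bad ≤ ENNReal.ofReal ((q - p) / 4) := by
    have hsub : bad ⊆ ⋃ b ∈ u, Metric.closedBall b.1 (5 * b.2) := by
      rintro s ⟨ε, hε, hs⟩
      have hmem : (s, ε) ∈ t := ⟨hε, hs.trans_le (measure_mono fun x hx => by
        simpa [Real.dist_eq] using le_of_lt hx)⟩
      obtain ⟨b, hb, hsb⟩ := hucov _ hmem
      exact mem_biUnion hb (hsb (Metric.mem_closedBall_self hε.le))
    calc volume bad ≤ volume (⋃ b ∈ u, Metric.closedBall b.1 (5 * b.2)) := measure_mono hsub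
      _ ≤ ∑' b : u, volume (Metric.closedBall b.1.1 (5 * b.1.2)) := measure_biUnion_le _ hucount _
      _ = ∑' b : u, ENNReal.ofReal (10 / K) * ENNReal.ofReal (K * b.1.2) := by
          congr with b
          rw [Real.volume_closedBall, ← ENNReal.ofReal_mul (by positivity)]
          congr 1
          field_simp
          ring
      _ ≤ ENNReal.ofReal (10 / K) * 1 := by
          rw [ENNReal.tsum_mul_left]
          gcongr
      _ = _ := by
          rw [mul_one, hK]
          congr 1
          field_simp
          norm_num
  have hlt : volume (bad ∪ Metric.closedBall c ((q - p) / 8)) < volume (Ioo p q) := by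
    calc volume (bad ∪ Metric.closedBall c ((q - p) / 8))
        ≤ ENNReal.ofReal ((q - p) / 4) + ENNReal.ofReal (2 * ((q - p) / 8)) :=
          (measure_union_le _ _).trans (add_le_add hbad (Real.volume_closedBall _ _).le)
      _ = ENNReal.ofReal ((q - p) / 2) := by
          rw [← ENNReal.ofReal_add (by positivity) (by positivity)]
          congr 1
          ring
      _ < volume (Ioo p q) := by
          rw [Real.volume_Ioo]
          exact (ENNReal.ofReal_lt_ofReal_iff hqp).2 (by linarith)
  obtain ⟨s, hs, hs'⟩ := not_subset.1 fun h => (measure_mono h).not_gt hlt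
  rw [mem_union, not_or] at hs'
  refine ⟨s, hs, by simpa [Real.dist_eq] using hs'.2, fun ε hε => ?_⟩
  by_contra! h
  exact hs'.1 ⟨ε, hε, h⟩

/-- A bounded set can be cut into small cells whose boundaries carry little mass of a given
measure, at all scales, and which do not separate the points near a given point `c`. -/
theorem exists_cells {X : Set (Space d)} (hX : Bornology.IsBounded X) {ℓ : ℝ} (hℓ : 0 < ℓ) :
    ∃ (m : ℕ) (K : ℝ), 0 ≤ K ∧ ∀ (ν : Measure (Space d)) [IsFiniteMeasure ν] (c : Space d),
      ∃ (C : Fin m → Set (Space d)) (N : ℝ → Set (Space d)),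
        (∀ j, IsOpen (C j)) ∧ Pairwise (Function.onFun Disjoint C) ∧
        (∀ j, ∀ x ∈ C j, ∀ y ∈ C j, dist x y ≤ ℓ) ∧
        (c ∈ X → ∃ j, Metric.closedBall c (ℓ / 32) ⊆ C j) ∧
        (∀ ε > 0, MeasurableSet (N ε) ∧ ν (N ε) ≤ ENNReal.ofReal (K * ε) * ν univ ∧
          X \ ⋃ j, C j ⊆ N ε ∧ ∀ j, innerBoundary ε (C j) ⊆ N ε) := by
  obtain ⟨t, htfin, ht⟩ := Metric.totallyBounded_iff.1
    (hX.isCompact_closure.totallyBounded.subset subset_closure) (ℓ / 4) (by positivity)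
  obtain ⟨m, a, hainj, hrange⟩ := htfin.fin_param
  -- One regular level is chosen for each of the m centres, between ℓ/4 and ℓ/2. The constant does
  -- not depend on ν or c, and the gap of an eighth of that interval is the ℓ/32 of the statement.
  refine ⟨m, m * (40 / (ℓ / 2 - ℓ / 4)), ?_, fun ν _ c => ?_⟩
  · have : 0 < ℓ / 2 - ℓ / 4 := by linarith
    positivity
  have hreg := fun j : Fin m => exists_regular_level ν (f := fun x => dist x (a j))
    (measurable_id.dist measurable_const) (p := ℓ / 4) (q := ℓ / 2) (by linarith) (dist c (a j))
  choose s hs hsc hsν using hreg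
  have hXcov : ∀ x ∈ X, ∃ j, dist x (a j) < ℓ / 4 := by
    intro x hx
    obtain ⟨y, hy, hxy⟩ := mem_iUnion₂.1 (ht hx)
    rw [← hrange] at hy
    obtain ⟨j, rfl⟩ := hy
    exact ⟨j, hxy⟩
  have hopen : ∀ j, IsOpen {x : Space d | dist x (a j) < s j ∧ ∀ i < j, s i < dist x (a i)} := by
    intro j
    rw [ofPred_and]
    refine (isOpen_lt (by fun_prop) continuous_const).inter ?_
    simp only [ofPred_forall]
    exact isOpen_iInter_of_finite fun i => isOpen_iInter_of_finite fun _ =>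
      isOpen_lt continuous_const (by fun_prop)
  -- Each cell is a ball minus the earlier closed balls, hence open; the points of X that are lost
  -- lie on the spheres of radius `s i`.
  refine ⟨fun j => {x | dist x (a j) < s j ∧ ∀ i < j, s i < dist x (a i)},
    fun ε => ⋃ j, {x | |dist x (a j) - s j| < ε}, hopen, ?_, ?_, ?_, fun ε hε => ⟨?_, ?_, ?_, ?_⟩⟩
  · intro i j hij
    refine disjoint_left.2 fun x hx hx' => ?_
    rcases lt_or_gt_of_ne hij with h | h
    · exact (hx'.2 i h).not_gt hx.1
    · exact (hx.2 j h).not_gt hx'.1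
  · intro j x hx y hy
    have := dist_triangle_right x y (a j)
    have h1 := hx.1
    have h2 := hy.1
    have h3 := (hs j).2
    linarith
  · intro hc
    have hex : ∃ j, dist c (a j) < s j := by
      obtain ⟨j, hj⟩ := hXcov c hc
      exact ⟨j, hj.trans (hs j).1⟩
    obtain ⟨j, hj, hmin⟩ := wellFounded_lt.has_min {j | dist c (a j) < s j} hex
    refine ⟨j, fun x hx => ?_⟩
    rw [Metric.mem_closedBall] at hx
    refine ⟨?_, fun i hi => ?_⟩
    · have h1 := hsc j
      have h2 := dist_triangle x c (a j)
      rw [abs_of_pos (sub_pos.2 hj)] at h1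
      linarith
    · have h0 : s i ≤ dist c (a i) := not_lt.1 fun h => hmin i h hi
      have h1 := hsc i
      have h2 := dist_triangle_left c (a i) x
      rw [abs_of_nonpos (sub_nonpos.2 h0)] at h1
      linarith
  · exact MeasurableSet.iUnion fun j => (isOpen_lt (by fun_prop) continuous_const).measurableSet
  · calc ν (⋃ j, {x | |dist x (a j) - s j| < ε})
        ≤ ∑ j, ν {x | |dist x (a j) - s j| < ε} := measure_iUnion_fintype_le _ _
      _ ≤ ∑ j : Fin m, ENNReal.ofReal (40 / (ℓ / 2 - ℓ / 4) * ε) * ν univ :=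
          Finset.sum_le_sum fun j _ => hsν j ε hε
      _ = _ := by
          rw [Finset.sum_const, Finset.card_univ, Fintype.card_fin, nsmul_eq_mul, mul_assoc (m : ℝ),
            ENNReal.ofReal_mul (Nat.cast_nonneg m), ENNReal.ofReal_natCast, mul_assoc]
  · rintro x ⟨hx, hx'⟩
    have hex : ∃ j, dist x (a j) < s j := by
      obtain ⟨j, hj⟩ := hXcov x hx
      exact ⟨j, hj.trans (hs j).1⟩
    obtain ⟨j, hj, hmin⟩ := wellFounded_lt.has_min {j | dist x (a j) < s j} hex
    have h0 : ¬ ∀ i < j, s i < dist x (a i) := fun h => hx' (mem_iUnion.2 ⟨j, hj, h⟩)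
    push Not at h0
    obtain ⟨i, hi, hle⟩ := h0
    have hge : s i ≤ dist x (a i) := not_lt.1 fun h => hmin i h hi
    refine mem_iUnion.2 ⟨i, ?_⟩
    rw [mem_ofPred_eq, le_antisymm hle hge, sub_self, abs_zero]
    exact hε
  · rintro j x ⟨-, hx⟩
    obtain ⟨y, hy, hxy⟩ := Metric.mem_thickening_iff.1 hx
    have hyj : ∃ i, dist y (a i) = s i := by
      rw [(hopen j).frontier_eq] at hy
      have hcl : dist y (a j) ≤ s j ∧ ∀ i < j, s i ≤ dist y (a i) := by
        have hclosed : IsClosed {x : Space d | dist x (a j) ≤ s j ∧ ∀ i < j, s i ≤ dist x (a i)} := by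
          rw [ofPred_and]
          refine (isClosed_le (by fun_prop) continuous_const).inter ?_
          simp only [ofPred_forall]
          exact isClosed_iInter fun i => isClosed_iInter fun _ =>
            isClosed_le continuous_const (by fun_prop)
        have hsub : {x : Space d | dist x (a j) < s j ∧ ∀ i < j, s i < dist x (a i)} ⊆
            {x : Space d | dist x (a j) ≤ s j ∧ ∀ i < j, s i ≤ dist x (a i)} :=
          fun x hx => ⟨hx.1.le, fun i hi => (hx.2 i hi).le⟩
        exact closure_minimal hsub hclosed hy.1
      by_contra! hne
      exact hy.2 ⟨lt_of_le_of_ne hcl.1 (hne j),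
        fun i hi => lt_of_le_of_ne (hcl.2 i hi) (hne i).symm⟩
    obtain ⟨i, hi⟩ := hyj
    refine mem_iUnion.2 ⟨i, ?_⟩
    rw [mem_ofPred_eq, ← hi]
    exact (abs_dist_sub_le x y (a i)).trans_lt hxy

/-! ### Inner boundaries and decompositions -/

theorem innerBoundary_subset {ε : ℝ} {A : Set (Space d)} : innerBoundary ε A ⊆ A :=
  inter_subset_left

theorem isOpen_innerBoundary {ε : ℝ} {A : Set (Space d)} (hA : IsOpen A) :
    IsOpen (innerBoundary ε A) :=
  hA.inter Metric.isOpen_thickening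

@[simp] theorem innerBoundary_empty {ε : ℝ} : innerBoundary ε (∅ : Set (Space d)) = ∅ := by
  simp [innerBoundary]

theorem innerBoundary_inter_subset {ε : ℝ} {A C : Set (Space d)} :
    innerBoundary ε (A ∩ C) ⊆ innerBoundary ε A ∪ innerBoundary ε C := by
  rintro x ⟨⟨hA, hC⟩, hx⟩
  obtain ⟨y, hy, hxy⟩ := Metric.mem_thickening_iff.1 hx
  rcases frontier_inter_subset A C hy with h | h
  · exact Or.inl ⟨hA, Metric.mem_thickening_iff.2 ⟨y, h.1, hxy⟩⟩
  · exact Or.inr ⟨hC, Metric.mem_thickening_iff.2 ⟨y, h.2, hxy⟩⟩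

/-- This clears the denominators in `complexity`. In positive dimension a bounded nonempty open set
is not clopen, so it has frontier points, and these are limits of interior points. -/
theorem volume_innerBoundary_ne_zero (hd : 1 ≤ d) {ε : ℝ} (hε : 0 < ε) {I : Set (Space d)}
    (hI : IsOpen I) (hne : I.Nonempty) (hb : Bornology.IsBounded I) :
    volume (innerBoundary ε I) ≠ 0 := by
  have : Nonempty (Fin d) := ⟨⟨0, hd⟩⟩
  have hfr : (frontier I).Nonempty := by
    rw [nonempty_iff_ne_empty]
    intro h
    rcases isClopen_iff.1 (isClopen_iff_frontier_eq_empty.2 h) with h | h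
    · exact hne.ne_empty h
    · rw [h] at hb
      exact NormedSpace.unbounded_univ ℝ (Space d) hb
  obtain ⟨y, hy⟩ := hfr
  obtain ⟨x, hx, hxy⟩ := Metric.mem_closure_iff.1 (frontier_subset_closure hy) ε hε
  refine ((isOpen_innerBoundary hI).measure_pos volume ⟨x, hx, ?_⟩).ne'
  exact Metric.mem_thickening_iff.2 ⟨y, hy, by rwa [dist_comm]⟩

theorem tsum_measure_inter_le {Ω ι : Type*} [MeasurableSpace Ω] [Countable ι] (μ : Measure Ω)
    {W : ι → Set Ω} (hW : ∀ i, MeasurableSet (W i)) (hd : Pairwise (Function.onFun Disjoint W))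
    (B : Set Ω) : ∑' i, μ (W i ∩ B) ≤ μ B := by
  calc ∑' i, μ (W i ∩ B) = ∑' i, μ.restrict B (W i) := by
        simp only [Measure.restrict_apply (hW _)]
    _ = μ.restrict B (⋃ i, W i) := (measure_iUnion hd hW).symm
    _ ≤ μ.restrict B univ := measure_mono (subset_univ _)
    _ = μ B := Measure.restrict_apply_univ B

/-- A countable family of sets, each with a time. -/
structure Family (d : ℕ) where
  ι : Type
  countable : Countable ι
  W : ι → Set (Space d)
  n : ι → ℕ

attribute [instance] Family.countable

/-- The total mass of the pulled back inner `ε`-boundaries of the images of the pieces. -/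
noncomputable def Family.boundaryMass (T : Space d → Space d) (F : Family d) (ε : ℝ) : ℝ≥0∞ :=
  ∑' i, volume (F.W i ∩ T^[F.n i] ⁻¹' innerBoundary ε (T^[F.n i] '' F.W i))

/-- `F` is a decomposition (mod 0) of `A \ R` into branch domains with small images. -/
structure IsDecomposition (T : Space d → Space d) (P : Set (Set (Space d))) (ℓ : ℝ)
    (F : Family d) (A R : Set (Space d)) : Prop where
  domain : ∀ i, IsBranchDomain T P (F.n i) (F.W i)
  subset : ∀ i, F.W i ⊆ A
  disjoint_hole : ∀ i, Disjoint (F.W i) R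
  disjoint : Pairwise (Function.onFun Disjoint F.W)
  diam_le : ∀ i, Metric.diam (T^[F.n i] '' F.W i) ≤ ℓ
  cover : volume (A \ (R ∪ ⋃ i, F.W i)) = 0

/-! ### One growth step -/

theorem cylinder_isBranchDomain (hS : IsExpandingSystem T X P lam ε₁ α D) {n : ℕ}
    (w : Fin n → P) : IsBranchDomain T P n (cylinder T w) := by
  refine ⟨?_, fun i hi => ⟨w ⟨i, hi⟩, (w ⟨i, hi⟩).2, fun x hx => hx ⟨i, hi⟩⟩⟩
  suffices h : ∀ m ≤ n, IsOpen {x : Space d | ∀ i : Fin n, (i : ℕ) < m → T^[(i : ℕ)] x ∈ (w i).1} by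
    convert h n le_rfl using 1
    ext x
    exact ⟨fun hx i _ => hx i, fun hx i => hx i i.2⟩
  intro m
  induction m with
  | zero => simp
  | succ m ih =>
    intro hm
    have hB : IsBranchDomain T P m
        {x : Space d | ∀ i : Fin n, (i : ℕ) < m → T^[(i : ℕ)] x ∈ (w i).1} :=
      ⟨ih (Nat.le_of_succ_le hm), fun i hi =>
        ⟨w ⟨i, by omega⟩, (w ⟨i, by omega⟩).2, fun x hx => hx ⟨i, by omega⟩ hi⟩⟩
    convert hB.isOpen_inter_preimage hS
      (hS.invertible.partition.isOpen _ (w ⟨m, hm⟩).2) using 1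
    ext x
    constructor
    · exact fun hx => ⟨fun i hi => hx i (hi.trans m.lt_succ_self), hx ⟨m, hm⟩ m.lt_succ_self⟩
    · rintro ⟨hx, hx'⟩ i hi
      rcases Nat.lt_succ_iff_lt_or_eq.1 hi with h | h
      · exact hx i h
      · obtain rfl : i = ⟨m, hm⟩ := Fin.ext h
        exact hx'

theorem IsBranchDomain.exists_subset_cylinder {n : ℕ} {V : Set (Space d)}
    (h : IsBranchDomain T P n V) : ∃ w : Fin n → P, V ⊆ cylinder T w := by
  choose O hO hm using fun i : Fin n => h.itinerary i i.2
  exact ⟨fun i => ⟨O i, hO i⟩, fun x hx i => hm i hx⟩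

theorem disjoint_cylinder (hS : IsExpandingSystem T X P lam ε₁ α D) {n : ℕ} {w w' : Fin n → P}
    (hw : w ≠ w') : Disjoint (cylinder T w) (cylinder T w') := by
  obtain ⟨i, hi⟩ := Function.ne_iff.1 hw
  refine disjoint_left.2 fun x hx hx' => ?_
  exact disjoint_left.1 (hS.invertible.partition.disjoint (w i).2 (w' i).2
    fun h => hi (Subtype.ext h)) (hx i) (hx' i)

/-- The mass controlled by the complexity of `T^n` on `I`. -/
theorem tsum_le_of_complexity_le (hS : IsExpandingSystem T X P lam ε₁ α D) (hd : 1 ≤ d) {n : ℕ}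
    {I : Set (Space d)} (hI : IsOpen I) (hIX : I ⊆ X) {ε s : ℝ} (hε : 0 < ε)
    (h : complexity T P lam n I ε ≤ ENNReal.ofReal s) :
    ∑' w : Fin n → P, volume ((cylinder T w ∩ T^[n] ⁻¹' innerBoundary ε (T^[n] '' (I ∩ cylinder T w)))
        \ innerBoundary (lam ^ n * ε) I) ≤
      ENNReal.ofReal s * volume (innerBoundary (lam ^ n * ε) I) := by
  rcases I.eq_empty_or_nonempty with rfl | hne
  · simp
  have hb := hS.bounded.subset hIX
  have hsup : Function.support (fun w : Fin n → P =>
      volume ((cylinder T w ∩ T^[n] ⁻¹' innerBoundary ε (T^[n] '' (I ∩ cylinder T w)))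
        \ innerBoundary (lam ^ n * ε) I)) ⊆ {w | 0 < volume (I ∩ cylinder T w)} := by
    intro w hw
    rw [mem_ofPred_eq, pos_iff_ne_zero]
    contrapose! hw
    rw [Function.notMem_support]
    refine measure_mono_null (fun x hx => ?_) hw
    obtain ⟨y, hy, hyx⟩ := innerBoundary_subset hx.1.2
    exact (cylinder_isBranchDomain hS w).injOn hS hy.2 hx.1.1 hyx ▸ hy
  rw [← tsum_subtype_eq_of_support_subset hsup, ← ENNReal.div_le_iff
    (volume_innerBoundary_ne_zero hd (mul_pos (pow_pos hS.lam_pos n) hε) hI hne hb)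
    ((measure_mono innerBoundary_subset).trans_lt hb.measure_lt_top).ne, div_eq_mul_inv,
    ← ENNReal.tsum_mul_right]
  exact h

/-- Every small open set `I` can be decomposed into branch domains of order `n` with small images,
with control of the boundary mass; the decomposition may be chosen so as not to separate the points
that are mapped near a given point `c`. -/
def HasStep (T : Space d → Space d) (X : Set (Space d)) (P : Set (Set (Space d)))
    (lam ℓ ε₂ : ℝ) (n : ℕ) (s K : ℝ) : Prop :=
  ∀ I : Set (Space d), IsOpen I → I ⊆ X → Metric.diam I ≤ ℓ → ∀ c : Space d,
    ∃ F : Family d, IsDecomposition T P ℓ F I ∅ ∧ (∀ i, F.n i = n) ∧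
      (∀ ε, 0 < ε → ε < ε₂ → F.boundaryMass T ε ≤
        ENNReal.ofReal (1 + s) * volume (innerBoundary (lam ^ n * ε) I) +
          ENNReal.ofReal (K * ε) * volume I) ∧
      ∀ V ⊆ I, IsBranchDomain T P n V → V.Nonempty →
        T^[n] '' V ⊆ Metric.closedBall c (ℓ / 32) → c ∈ X → ∃ i, V ⊆ F.W i

/-- Evolving a small open set by `T^n` and cutting the images of the pieces: the boundary mass is
controlled by the complexity. -/
theorem exists_hasStep (hS : IsExpandingSystem T X P lam ε₁ α D) (hd : 1 ≤ d) (n : ℕ)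
    {s ε₂ ℓ : ℝ} (hs : 0 ≤ s) (hℓ : 0 < ℓ) (hℓ2 : ℓ ≤ ε₂)
    (hcomp : ∀ I : Set (Space d), IsOpen I → I ⊆ X → Metric.diam I ≤ ε₂ → ∀ ε : ℝ, 0 < ε →
      ε < ε₂ → complexity T P lam n I ε ≤ ENNReal.ofReal s) :
    ∃ K : ℝ, 0 ≤ K ∧ HasStep T X P lam ℓ ε₂ n s K := by
  obtain ⟨m, K, hK, hcells⟩ := exists_cells hS.bounded hℓ
  refine ⟨K, hK, fun I hI hIX hIdiam c => ?_⟩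
  have hIb := hS.bounded.subset hIX
  have : IsFiniteMeasure (volume.restrict I) := ⟨by simpa using hIb.measure_lt_top⟩
  have : Countable P := hS.invertible.partition.countable
  have hTn := hS.measurable_iterate n
  obtain ⟨C, N, hCo, hCd, hCdiam, hCc, hCN⟩ := hcells ((volume.restrict I).map T^[n]) c
  have hNvol : ∀ ε > 0, volume (I ∩ T^[n] ⁻¹' N ε) ≤ ENNReal.ofReal (K * ε) * volume I := by
    intro ε hε
    have := (hCN ε hε).2.1
    rw [Measure.map_apply hTn (hCN ε hε).1, Measure.map_apply hTn MeasurableSet.univ,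
      Measure.restrict_apply (hTn (hCN ε hε).1), preimage_univ, Measure.restrict_apply_univ,
      inter_comm] at this
    exact this
  have hdom : ∀ w : Fin n → P, IsBranchDomain T P n (I ∩ cylinder T w) := fun w =>
    (cylinder_isBranchDomain hS w).mono (hI.inter (cylinder_isBranchDomain hS w).isOpen)
      inter_subset_right
  let W : (Fin n → P) × Fin m → Set (Space d) := fun p => I ∩ cylinder T p.1 ∩ T^[n] ⁻¹' C p.2
  have hWdom : ∀ p, IsBranchDomain T P n (W p) := fun p =>
    (hdom p.1).inter_preimage hS (hCo p.2)
  have hWimg : ∀ p, T^[n] '' W p = T^[n] '' (I ∩ cylinder T p.1) ∩ C p.2 := fun p =>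
    image_inter_preimage _ _ _
  have hWdisj : Pairwise (Function.onFun Disjoint W) := by
    rintro ⟨w, j⟩ ⟨w', j'⟩ hne
    by_cases hw : w = w'
    · have hj : j ≠ j' := fun h => hne (by rw [hw, h])
      exact ((hCd hj).preimage _).mono inter_subset_right inter_subset_right
    · exact (disjoint_cylinder hS hw).mono (inter_subset_left.trans inter_subset_right)
        (inter_subset_left.trans inter_subset_right)
  refine ⟨⟨(Fin n → P) × Fin m, inferInstance, W, fun _ => n⟩,
    ⟨hWdom, fun p => inter_subset_left.trans inter_subset_left, fun _ => disjoint_empty _, hWdisj,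
      fun p => ?_, ?_⟩, fun _ => rfl, fun ε hε hε2 => ?_, ?_⟩
  · refine Metric.diam_le_of_forall_dist_le hℓ.le fun x hx y hy => ?_
    rw [hWimg] at hx hy
    exact hCdiam _ x hx.2 y hy.2
  · have h1 : volume {x ∈ I | ¬ ∀ k, T^[k] x ∈ ⋃₀ P} = 0 := by
      refine measure_mono_null (fun x hx => ?_) (ae_iff.1
        ((ae_restrict_iff' hS.measurableSet).1 hS.ae_iterate_mem))
      exact fun h => hx.2 (h (hIX hx.1))
    -- Points missed by the cells lie in `N ε` for every ε, so their mass is at most O(ε) for every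
    -- ε.
    have h2 : volume (I ∩ T^[n] ⁻¹' (X \ ⋃ j, C j)) = 0 := by
      have hlim : Tendsto (fun k : ℕ => ENNReal.ofReal (K * (1 / ((k : ℝ) + 1))) * volume I) atTop
          (𝓝 (ENNReal.ofReal (K * 0) * volume I)) :=
        ENNReal.Tendsto.mul_const (ENNReal.tendsto_ofReal
          (tendsto_one_div_add_atTop_nhds_zero_nat.const_mul K)) (Or.inr hIb.measure_lt_top.ne)
      rw [mul_zero, ENNReal.ofReal_zero, zero_mul] at hlim
      refine le_antisymm (ge_of_tendsto' hlim fun k => ?_) zero_le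
      refine (measure_mono ?_).trans (hNvol _ Nat.one_div_pos_of_nat)
      exact inter_subset_inter_right _ (preimage_mono (hCN _ Nat.one_div_pos_of_nat).2.2.1)
    refine measure_mono_null (fun x hx => ?_) (measure_union_null h1 h2)
    rw [mem_union, or_iff_not_imp_left]
    intro hx1
    have hx2 : ∀ k, T^[k] x ∈ ⋃₀ P := by
      by_contra h
      exact hx1 ⟨hx.1, h⟩
    choose O hO hxO using hx2
    have hxw : x ∈ I ∩ cylinder T (fun i : Fin n => (⟨O i, hO i⟩ : P)) :=
      ⟨hx.1, fun i => hxO i⟩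
    refine ⟨hx.1, (hdom _).image_subset hS (inter_subset_left.trans hIX)
      (mem_image_of_mem _ hxw), fun hxC => ?_⟩
    obtain ⟨j, hj⟩ := mem_iUnion.1 hxC
    exact hx.2 (Or.inr (mem_iUnion.2 ⟨(_, j), hxw, hj⟩))
  · set B := innerBoundary (lam ^ n * ε) I
    set A : (Fin n → P) → Set (Space d) := fun w =>
      (cylinder T w ∩ T^[n] ⁻¹' innerBoundary ε (T^[n] '' (I ∩ cylinder T w))) \ B
    -- Points already in the pulled-back boundary `B` of I are set aside and counted once; they are
    -- the 1 in 1 + s. The others are charged to the complexity sum or to the walls of the cells.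
    have hsub : ∀ p, W p ∩ T^[n] ⁻¹' innerBoundary ε (T^[n] '' W p) ⊆
        (T^[n] ⁻¹' C p.2 ∩ A p.1) ∪ (W p ∩ (B ∪ I ∩ T^[n] ⁻¹' N ε)) := by
      rintro p x ⟨hxW, hx⟩
      by_cases hxB : x ∈ B
      · exact Or.inr ⟨hxW, Or.inl hxB⟩
      rw [mem_preimage, hWimg] at hx
      rcases innerBoundary_inter_subset hx with h | h
      · exact Or.inl ⟨hxW.2, ⟨hxW.1.2, h⟩, hxB⟩
      · exact Or.inr ⟨hxW, Or.inr ⟨hxW.1.1, (hCN ε hε).2.2.2 _ h⟩⟩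
    calc ∑' p, volume (W p ∩ T^[n] ⁻¹' innerBoundary ε (T^[n] '' W p))
        ≤ ∑' p, (volume (T^[n] ⁻¹' C p.2 ∩ A p.1) + volume (W p ∩ (B ∪ I ∩ T^[n] ⁻¹' N ε))) :=
          ENNReal.tsum_le_tsum fun p => (measure_mono (hsub p)).trans (measure_union_le _ _)
      _ = ∑' w, ∑' j, volume (T^[n] ⁻¹' C j ∩ A w) +
          ∑' p, volume (W p ∩ (B ∪ I ∩ T^[n] ⁻¹' N ε)) := by
          rw [ENNReal.tsum_add, ENNReal.tsum_prod' (f := fun p : (Fin n → P) × Fin m =>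
            volume (T^[n] ⁻¹' C p.2 ∩ A p.1))]
      _ ≤ ∑' w, volume (A w) + volume (B ∪ I ∩ T^[n] ⁻¹' N ε) := by
          refine add_le_add (ENNReal.tsum_le_tsum fun w => ?_) ?_
          · exact tsum_measure_inter_le volume (fun j => hTn (hCo j).measurableSet)
              (fun i j hij => (hCd hij).preimage _) _
          · exact tsum_measure_inter_le volume (fun p => (hWdom p).isOpen.measurableSet) hWdisj _
      _ ≤ ENNReal.ofReal s * volume B + (volume B + ENNReal.ofReal (K * ε) * volume I) := by
          refine add_le_add (tsum_le_of_complexity_le hS hd hI hIX hε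
            (hcomp I hI hIX (hIdiam.trans hℓ2) ε hε hε2)) ?_
          exact (measure_union_le _ _).trans (add_le_add le_rfl (hNvol ε hε))
      _ = _ := by
          rw [ENNReal.ofReal_add zero_le_one hs, ENNReal.ofReal_one]
          ring
  · intro V hVI hV hne hVc hcX
    obtain ⟨w, hw⟩ := hV.exists_subset_cylinder
    obtain ⟨j, hj⟩ := hCc hcX
    exact ⟨(w, j), fun x hx => ⟨⟨hVI hx, hw hx⟩, hj (hVc (mem_image_of_mem _ hx))⟩⟩

/-! ### Composing decompositions -/

theorem IsExpandingSystem.volume_inter_preimage_null (hS : IsExpandingSystem T X P lam ε₁ α D)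
    {W N : Set (Space d)} (hW : W ⊆ X) (n : ℕ) (hN : volume N = 0) :
    volume (W ∩ T^[n] ⁻¹' N) = 0 := by
  have h := (hS.quasi.iterate n).preimage_null
    (le_antisymm ((Measure.restrict_le_self (s := X) N).trans_eq hN) zero_le)
  rw [Measure.restrict_apply' hS.measurableSet] at h
  have hsub : W ∩ T^[n] ⁻¹' N ⊆ T^[n] ⁻¹' N ∩ X := fun x hx => ⟨hx.2, hW hx.1⟩
  exact measure_mono_null hsub h

theorem image_iterate_add_inter_preimage {m n : ℕ} {V W : Set (Space d)}
    (hV : V ⊆ T^[n] '' W) : T^[n + m] '' (W ∩ T^[n] ⁻¹' V) = T^[m] '' V := by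
  rw [add_comm, Function.iterate_add, image_comp, image_inter_preimage, inter_eq_right.2 hV]

/-- The pieces of `G i`, pulled back to the pieces of `F`. -/
def Family.bind (T : Space d → Space d) (F : Family d) (G : F.ι → Family d) : Family d where
  ι := Σ i, (G i).ι
  countable := inferInstance
  W := fun p => F.W p.1 ∩ T^[F.n p.1] ⁻¹' (G p.1).W p.2
  n := fun p => F.n p.1 + (G p.1).n p.2

namespace IsDecomposition

/-- What is uncovered was either missed by `F` or sent into a null set by one of its branches;
non-singularity makes the preimage null. Holes accumulate: the old hole is kept and the holes of the
images are pulled back. -/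
theorem bind (hS : IsExpandingSystem T X P lam ε₁ α D) {ℓ : ℝ} {F : Family d}
    {A R₀ : Set (Space d)} (hA : A ⊆ X) (hF : IsDecomposition T P ℓ F A R₀) {G : F.ι → Family d}
    {R : F.ι → Set (Space d)}
    (hG : ∀ i, IsDecomposition T P ℓ (G i) (T^[F.n i] '' F.W i) (R i)) :
    IsDecomposition T P ℓ (F.bind T G) A (R₀ ∪ ⋃ i, F.W i ∩ T^[F.n i] ⁻¹' R i) where
  domain p := (hF.domain p.1).comp hS ((hG p.1).domain p.2)
  subset p := inter_subset_left.trans (hF.subset p.1)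
  disjoint_hole p := by
    refine disjoint_union_right.2 ⟨(hF.disjoint_hole p.1).mono_left inter_subset_left, ?_⟩
    refine disjoint_iUnion_right.2 fun i => ?_
    by_cases h : p.1 = i
    · subst h
      exact (((hG p.1).disjoint_hole p.2).preimage _).mono inter_subset_right inter_subset_right
    · exact (hF.disjoint h).mono inter_subset_left inter_subset_left
  disjoint := by
    rintro ⟨i, j⟩ ⟨i', j'⟩ hne
    by_cases h : i = i'
    · subst h
      have hj : j ≠ j' := fun h => hne (by rw [h])
      exact (((hG i).disjoint hj).preimage _).mono inter_subset_right inter_subset_right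
    · exact (hF.disjoint h).mono inter_subset_left inter_subset_left
  diam_le p := by
    have := (hG p.1).diam_le p.2
    rwa [← image_iterate_add_inter_preimage ((hG p.1).subset p.2)] at this
  cover := by
    have h1 : ∀ i, volume (F.W i ∩ T^[F.n i] ⁻¹'
        (T^[F.n i] '' F.W i \ (R i ∪ ⋃ j, (G i).W j))) = 0 := fun i =>
      hS.volume_inter_preimage_null ((hF.subset i).trans hA) _ (hG i).cover
    refine measure_mono_null (fun x hx => ?_)
      (measure_union_null hF.cover (measure_iUnion_null h1))
    rw [mem_union, or_iff_not_imp_left]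
    intro hx1
    have hx2 : x ∈ ⋃ i, F.W i := by
      by_contra h
      exact hx1 ⟨hx.1, fun h' => h'.elim (fun h' => hx.2 (Or.inl (Or.inl h'))) h⟩
    obtain ⟨i, hi⟩ := mem_iUnion.1 hx2
    refine mem_iUnion.2 ⟨i, hi, mem_image_of_mem _ hi, ?_⟩
    rintro (h | h)
    · exact hx.2 (Or.inl (Or.inr (mem_iUnion.2 ⟨i, hi, h⟩)))
    · obtain ⟨j, hj⟩ := mem_iUnion.1 h
      exact hx.2 (Or.inr (mem_iUnion.2 ⟨⟨i, j⟩, hi, hj⟩))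

/-- On each piece the pulled-back measure is a constant times Lebesgue measure, up to the distortion
factor. The constants cancel between the two sides, so each composition costs a single factor b,
however long the branches of `F` are. -/
theorem boundaryMass_bind_le (hS : IsExpandingSystem T X P lam ε₁ α D) {ℓ : ℝ} (hℓ : ℓ ≤ ε₁)
    {F : Family d} {A R₀ : Set (Space d)} (hA : A ⊆ X) (hF : IsDecomposition T P ℓ F A R₀)
    {G : F.ι → Family d} {R : F.ι → Set (Space d)}
    (hG : ∀ i, IsDecomposition T P ℓ (G i) (T^[F.n i] '' F.W i) (R i))
    (hR : ∀ i, R i ⊆ T^[F.n i] '' F.W i) (hRm : ∀ i, MeasurableSet (R i))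
    {ε ε' : ℝ} {s C C' : ℝ≥0∞}
    (hbd : ∀ i, (G i).boundaryMass T ε ≤ s * volume (innerBoundary ε' (T^[F.n i] '' F.W i)) +
      C * volume (T^[F.n i] '' F.W i) + C' * volume (R i)) :
    (F.bind T G).boundaryMass T ε ≤ ENNReal.ofReal (distortionFactor lam α D ℓ) *
      (s * F.boundaryMass T ε' + C * ∑' i, volume (F.W i) +
        C' * ∑' i, volume (F.W i ∩ T^[F.n i] ⁻¹' R i)) := by
  set b := ENNReal.ofReal (distortionFactor lam α D ℓ)
  rw [Family.boundaryMass, Family.boundaryMass, ← ENNReal.tsum_mul_left, ← ENNReal.tsum_mul_left,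
    ← ENNReal.tsum_mul_left, ← ENNReal.tsum_add, ← ENNReal.tsum_add, ← ENNReal.tsum_mul_left,
    Family.bind, ENNReal.tsum_sigma']
  refine ENNReal.tsum_le_tsum fun i => ?_
  obtain ⟨κ, hκ0, hκt, hκ⟩ := (hF.domain i).exists_comparison hS ((hF.subset i).trans hA) hℓ
    (hF.diam_le i)
  have hI := (hF.domain i).isOpen_image hS
  have hVo : ∀ j, IsOpen (innerBoundary ε (T^[(G i).n j] '' (G i).W j)) := fun j =>
    isOpen_innerBoundary (((hG i).domain j).isOpen_image hS)
  calc ∑' j, volume (F.W i ∩ T^[F.n i] ⁻¹' (G i).W j ∩ T^[F.n i + (G i).n j] ⁻¹'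
        innerBoundary ε (T^[F.n i + (G i).n j] '' (F.W i ∩ T^[F.n i] ⁻¹' (G i).W j)))
      ≤ ∑' j, b * (κ * volume ((G i).W j ∩
          T^[(G i).n j] ⁻¹' innerBoundary ε (T^[(G i).n j] '' (G i).W j))) := by
        refine ENNReal.tsum_le_tsum fun j => ?_
        rw [image_iterate_add_inter_preimage ((hG i).subset j)]
        refine le_of_eq_of_le ?_ (hκ _ (((hG i).domain j).isOpen_inter_preimage hS
          (hVo j)).measurableSet (inter_subset_left.trans ((hG i).subset j))).2
        rw [add_comm, Function.iterate_add, preimage_comp, preimage_inter, inter_assoc]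
    _ = b * (κ * (G i).boundaryMass T ε) := by
        rw [ENNReal.tsum_mul_left, ENNReal.tsum_mul_left, Family.boundaryMass]
    _ ≤ b * (κ * (s * volume (innerBoundary ε' (T^[F.n i] '' F.W i)) +
          C * volume (T^[F.n i] '' F.W i) + C' * volume (R i))) := by
        gcongr
        exact hbd i
    _ = b * (s * (κ * volume (innerBoundary ε' (T^[F.n i] '' F.W i))) +
          C * (κ * volume (T^[F.n i] '' F.W i)) + C' * (κ * volume (R i))) := by ring
    _ ≤ _ := by
        have h1 := (hκ _ (isOpen_innerBoundary (ε := ε') hI).measurableSet innerBoundary_subset).1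
        have h2 := (hκ _ hI.measurableSet subset_rfl).1
        rw [inter_eq_left.2 (subset_preimage_image _ _)] at h2
        have h3 := (hκ _ (hRm i) (hR i)).1
        gcongr

theorem measure_le {ℓ : ℝ} {F : Family d} {A R : Set (Space d)} (hF : IsDecomposition T P ℓ F A R) : ∑' i, volume (F.W i) ≤ volume A := by
  rw [← measure_iUnion hF.disjoint fun i => (hF.domain i).isOpen.measurableSet]
  exact measure_mono (iUnion_subset hF.subset)

end IsDecomposition

/-- The family with the single piece `A`, at time `0`. -/
def Family.single (A : Set (Space d)) : Family d where
  ι := Unit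
  countable := inferInstance
  W := fun _ => A
  n := fun _ => 0

theorem isDecomposition_single {ℓ : ℝ} {A : Set (Space d)} (hA : IsOpen A)
    (hdiam : Metric.diam A ≤ ℓ) : IsDecomposition T P ℓ (Family.single A) A ∅ where
  domain _ := isBranchDomain_zero hA
  subset _ := subset_rfl
  disjoint_hole _ := disjoint_empty _
  disjoint := fun _ _ h => absurd rfl h
  diam_le _ := by simpa [Family.single] using hdiam
  cover := measure_mono_null (fun _ hx => hx.2 (Or.inr (mem_iUnion.2 ⟨(), hx.1⟩)))
    measure_empty

theorem boundaryMass_single {A : Set (Space d)} {ε : ℝ} :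
    (Family.single A).boundaryMass T ε = volume (innerBoundary ε A) := by
  have : ∑' _ : Unit, volume (A ∩ T^[0] ⁻¹' innerBoundary ε (T^[0] '' A)) =
      volume (innerBoundary ε A) := by
    simp [inter_eq_right.2 innerBoundary_subset]
  exact this

/-- A ball is connected, so one that misses the frontier of I and has its centre in I stays in I.
This is how pieces are seen to contain templates. -/
theorem ball_subset_of_notMem_innerBoundary {I : Set (Space d)} (hI : IsOpen I) {x : Space d}
    (hx : x ∈ I) {δ : ℝ} (hδ : 0 < δ) (h : x ∉ innerBoundary δ I) : Metric.ball x δ ⊆ I := by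
  have hdisj : ∀ y ∈ Metric.ball x δ, y ∉ frontier I := fun y hy hyI =>
    h ⟨hx, Metric.mem_thickening_iff.2 ⟨y, hyI, by rwa [dist_comm]⟩⟩
  refine (convex_ball x δ).isPreconnected.subset_left_of_subset_union hI
    isClosed_closure.isOpen_compl (disjoint_compl_right.mono_left subset_closure) (fun y hy => ?_)
    ⟨x, Metric.mem_ball_self hδ, hx⟩
  by_cases hyc : y ∈ closure I
  · left
    by_contra hyI
    exact hdisj y hy (by rw [hI.frontier_eq]; exact ⟨hyc, hyI⟩)
  · exact Or.inr hyc

/-! ### Regular sublevel sets and reachability -/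

/-- Points near the frontier of a sublevel set of a 1-Lipschitz function have values near the
level. -/
theorem thickening_frontier_sublevel_subset {f : Space d → ℝ} (hf : LipschitzWith 1 f) (s ε : ℝ) :
    Metric.thickening ε (frontier {x | f x < s}) ⊆ {x | |f x - s| < ε} := by
  intro x hx
  obtain ⟨y, hy, hxy⟩ := Metric.mem_thickening_iff.1 hx
  have hys : f y = s := frontier_lt_subset_eq hf.continuous continuous_const hy
  rw [mem_ofPred_eq, ← hys, ← Real.dist_eq]
  exact ((hf.dist_le_mul x y).trans_eq (by simp)).trans_lt hxy

/-- A 1-Lipschitz function has, between any two levels, a sublevel set whose boundary carries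
little Lebesgue measure. -/
theorem IsExpandingSystem.exists_regular_sublevel (hS : IsExpandingSystem T X P lam ε₁ α D)
    {f : Space d → ℝ} (hf : LipschitzWith 1 f) {ρ ρ' : ℝ} (hρ : ρ < ρ') :
    ∃ s ∈ Ioo ρ ρ', ∃ K : ℝ, 0 ≤ K ∧ ∀ ε > 0,
      volume (X ∩ Metric.thickening ε (frontier {x | f x < s})) ≤ ENNReal.ofReal (K * ε) := by
  have : IsFiniteMeasure (volume.restrict X) := ⟨by simpa using hS.volume_lt_top⟩
  obtain ⟨s, hs, -, h⟩ := exists_regular_level (volume.restrict X) hf.continuous.measurable hρ 0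
  refine ⟨s, hs, 40 / (ρ' - ρ) * volume.real X, ?_, fun ε hε => ?_⟩
  · have := sub_pos.2 hρ
    positivity
  have h1 := h ε hε
  rw [Measure.restrict_apply_univ, Measure.restrict_apply' hS.measurableSet] at h1
  rw [inter_comm]
  refine ((measure_mono (inter_subset_inter_left _
    (thickening_frontier_sublevel_subset hf s ε))).trans h1).trans_eq ?_
  rw [mul_right_comm, ENNReal.ofReal_mul (p := 40 / (ρ' - ρ) * ε)
    (by have := sub_pos.2 hρ; positivity), Measure.real,
    ENNReal.ofReal_toReal hS.volume_lt_top.ne]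

/-- Some branch of an iterate of `T` maps an open subset of `A` onto `A'`. -/
def Reaches (T : Space d → Space d) (P : Set (Set (Space d))) (A A' : Set (Space d)) : Prop :=
  ∃ t, 1 ≤ t ∧ ∃ V ⊆ A, IsBranchDomain T P t V ∧ T^[t] '' V = A'

namespace Reaches

theorem mono {A A₁ A' : Set (Space d)} (h : Reaches T P A A') (hA : A ⊆ A₁) :
    Reaches T P A₁ A' :=
  let ⟨t, ht, V, hV, h⟩ := h
  ⟨t, ht, V, hV.trans hA, h⟩

theorem of_subset (hS : IsExpandingSystem T X P lam ε₁ α D) {A A' A'' : Set (Space d)}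
    (h : Reaches T P A A') (hA : A'' ⊆ A') (ho : IsOpen A'') : Reaches T P A A'' := by
  obtain ⟨t, ht, V, hV, hVd, rfl⟩ := h
  exact ⟨t, ht, V ∩ T^[t] ⁻¹' A'', inter_subset_left.trans hV, hVd.inter_preimage hS ho, by
    rw [image_inter_preimage, inter_eq_right.2 hA]⟩

theorem trans (hS : IsExpandingSystem T X P lam ε₁ α D) {A A' A'' : Set (Space d)}
    (h : Reaches T P A A') (h' : Reaches T P A' A'') : Reaches T P A A'' := by
  obtain ⟨t, ht, V, hV, hVd, rfl⟩ := h
  obtain ⟨t', -, V', hV', hVd', rfl⟩ := h'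
  exact ⟨t + t', ht.trans (Nat.le_add_right _ _), V ∩ T^[t] ⁻¹' V', inter_subset_left.trans hV,
    hVd.comp hS hVd', image_iterate_add_inter_preimage hV'⟩

end Reaches

/-! ### Growth of pieces under iteration -/

/-- Under iteration of an expanding step, the boundary mass of the pieces stays controlled. -/
theorem exists_iterated_step (hS : IsExpandingSystem T X P lam ε₁ α D) {ℓ ε₂ s K : ℝ} {n : ℕ}
    (hℓ : ℓ ≤ ε₁) (hs : 0 ≤ s) (hK : 0 ≤ K) (hstep : HasStep T X P lam ℓ ε₂ n s K) {θ : ℝ}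
    (hθ : θ = distortionFactor lam α D ℓ * (1 + s) * lam ^ n) (hθ1 : θ < 1)
    {A : Set (Space d)} (hA : IsOpen A) (hAX : A ⊆ X) (hdiam : Metric.diam A ≤ ℓ) {B : ℝ}
    (hB : 0 ≤ B) (hbd : ∀ ε, 0 < ε → ε < ε₂ →
      volume (innerBoundary ε A) ≤ ENNReal.ofReal (B * ε)) (k : ℕ) :
    ∃ F : Family d, IsDecomposition T P ℓ F A ∅ ∧ (∀ i, F.n i = k * n) ∧
      ∀ ε, 0 < ε → ε < ε₂ → F.boundaryMass T ε ≤ ENNReal.ofReal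
        ((θ ^ k * B + distortionFactor lam α D ℓ * K * volume.real A / (1 - θ)) * ε) := by
  have hb := distortionFactor_pos lam α D ℓ
  have hlam := hS.lam_pos
  have hθ0 : 0 < θ := by rw [hθ]; positivity
  have hθ1' : 0 < 1 - θ := sub_pos.2 hθ1
  set b := distortionFactor lam α D ℓ
  induction k with
  | zero =>
    refine ⟨Family.single A, isDecomposition_single hA hdiam, fun _ => by simp [Family.single],
      fun ε hε hε2 => ?_⟩
    rw [boundaryMass_single]
    refine (hbd ε hε hε2).trans (ENNReal.ofReal_le_ofReal ?_)
    have : 0 ≤ b * K * volume.real A / (1 - θ) := by positivity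
    rw [pow_zero, one_mul]
    gcongr
    linarith
  | succ k ih =>
    obtain ⟨F, hF, hFn, hFbd⟩ := ih
    have hG := fun i => hstep (T^[F.n i] '' F.W i) ((hF.domain i).isOpen_image hS)
      ((hF.domain i).image_subset hS ((hF.subset i).trans hAX)) (hF.diam_le i) 0
    choose G hG hGn hGbd _ using hG
    refine ⟨F.bind T G, ?_, fun p => ?_, fun ε hε hε2 => ?_⟩
    · simpa using hF.bind hS hAX hG
    · simp only [Family.bind]
      rw [hFn, hGn]
      ring
    have hε' : 0 < lam ^ n * ε := by positivity
    have hle : lam ^ n * ε ≤ ε :=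
      mul_le_of_le_one_left hε.le (pow_le_one₀ hlam.le hS.lam_lt_one.le)
    have h1 := hF.boundaryMass_bind_le hS hℓ hAX hG (fun i => empty_subset _)
      (fun _ => MeasurableSet.empty) (C' := 0) (ε := ε) (ε' := lam ^ n * ε)
      (s := ENNReal.ofReal (1 + s)) (C := ENNReal.ofReal (K * ε))
      fun i => by simpa using hGbd i ε hε hε2
    refine h1.trans ?_
    rw [zero_mul, add_zero]
    have hAm : ∑' i, volume (F.W i) ≤ ENNReal.ofReal (volume.real A) := by
      rw [Measure.real, ENNReal.ofReal_toReal (hS.bounded.subset hAX).measure_lt_top.ne]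
      exact hF.measure_le
    refine (mul_le_mul_right (add_le_add (mul_le_mul_right (hFbd _ hε' (hle.trans_lt hε2)) _)
      (mul_le_mul_right hAm _)) _).trans ?_
    rw [← ENNReal.ofReal_mul (by positivity), ← ENNReal.ofReal_mul (by positivity),
      ← ENNReal.ofReal_add (by positivity) (by positivity), ← ENNReal.ofReal_mul hb.le]
    refine ENNReal.ofReal_le_ofReal (le_of_eq ?_)
    have h2 : b * ((1 + s) * ((θ ^ k * B + b * K * volume.real A / (1 - θ)) * (lam ^ n * ε)) +
        K * ε * volume.real A) =
        (b * (1 + s) * lam ^ n) * (θ ^ k * B + b * K * volume.real A / (1 - θ)) * ε +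
          b * K * volume.real A * ε := by ring
    rw [h2, ← hθ]
    field_simp
    ring

/-- Continuity from above along the tail unions, each of which has mass at least c; finiteness of `μ
A` is what permits it. -/
theorem le_measure_frequently {Ω : Type*} [MeasurableSpace Ω] {μ : Measure Ω} {G : ℕ → Set Ω}
    (hG : ∀ n, MeasurableSet (G n)) {A : Set Ω} (hA : μ A ≠ ∞) (hGA : ∀ n, G n ⊆ A) {c : ℝ≥0∞}
    (h : ∃ᶠ n in atTop, c ≤ μ (G n)) : c ≤ μ {x | ∃ᶠ n in atTop, x ∈ G n} := by
  have heq : {x | ∃ᶠ n in atTop, x ∈ G n} = ⋂ N : ℕ, ⋃ n ≥ N, G n := by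
    ext x
    simp [frequently_atTop]
  rw [heq]
  have hlim := tendsto_measure_iInter_atTop (μ := μ) (s := fun N : ℕ => ⋃ n ≥ N, G n)
    (fun N => (MeasurableSet.iUnion fun n => MeasurableSet.iUnion fun _ => hG n).nullMeasurableSet)
    (fun N N' hN => iUnion₂_mono' fun n hn => ⟨n, le_trans hN hn, subset_rfl⟩)
    ⟨0, ((measure_mono (iUnion₂_subset fun n _ => hGA n)).trans_lt hA.lt_top).ne⟩
  refine ge_of_tendsto' hlim fun N => ?_
  obtain ⟨n, hn, hcn⟩ := frequently_atTop.1 h N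
  exact hcn.trans (measure_mono (subset_iUnion₂ (s := fun n (_ : n ≥ N) => G n) n hn))

/-- Every open set has many points whose orbits pass infinitely often through templates that are
reached by the open set. -/
theorem measure_frequently_reaches_pos (hS : IsExpandingSystem T X P lam ε₁ α D)
    {ℓ ε₂ s K δ : ℝ} {n : ℕ} (hn : 1 ≤ n) (hℓ0 : 0 < ℓ)
    (hℓ : ℓ ≤ ε₁) (hs : 0 ≤ s) (hK : 0 ≤ K) (hstep : HasStep T X P lam ℓ ε₂ n s K) {θ : ℝ}
    (hθ : θ = distortionFactor lam α D ℓ * (1 + s) * lam ^ n) (hθ1 : θ < 1)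
    (hδ : 0 < δ) (hδ2 : δ < ε₂) (hδK : distortionFactor lam α D ℓ * K / (1 - θ) * δ ≤ 1 / 4)
    {ι : Type*} {B : ι → Set (Space d)} (hB : ∀ j, IsOpen (B j))
    (hcov : ∀ x ∈ X, ∃ j, x ∈ B j ∧ B j ⊆ Metric.ball x δ)
    {A : Set (Space d)} (hA : IsOpen A) (hne : A.Nonempty) (hAX : A ⊆ X) :
    0 < volume {x | ∃ᶠ k in atTop, x ∈ A ∩ T^[k] ⁻¹' ⋃ j ∈ {j | Reaches T P A (B j)}, B j} := by
  have hlam := hS.lam_pos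
  have hθ0 : 0 < θ := by rw [hθ]; have := distortionFactor_pos lam α D ℓ; positivity
  obtain ⟨a, ha⟩ := hne
  obtain ⟨ρ, hρ, hρA⟩ := Metric.isOpen_iff.1 hA a ha
  -- The boundary of A is arbitrary, so the iteration starts from a ball inside A whose boundary
  -- satisfies a linear bound.
  obtain ⟨r, hr, Kr, hKr, hreg⟩ := hS.exists_regular_sublevel (LipschitzWith.dist_left a)
    (ρ := 0) (ρ' := min ρ (ℓ / 2)) (by positivity)
  set A' : Set (Space d) := Metric.ball a r
  have hA'A : A' ⊆ A := (Metric.ball_subset_ball (hr.2.le.trans (min_le_left _ _))).trans hρA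
  have hA'X := hA'A.trans hAX
  have hA'diam : Metric.diam A' ≤ ℓ := (Metric.diam_ball hr.1.le).trans
    (by have := hr.2.le.trans (min_le_right _ _); linarith)
  have hA'fin : volume A' ≠ ∞ := Metric.isBounded_ball.measure_lt_top.ne
  have hA'pos : 0 < volume A' := Metric.measure_ball_pos _ _ hr.1
  have hA'real : 0 < volume.real A' := ENNReal.toReal_pos hA'pos.ne' hA'fin
  have hiter := exists_iterated_step hS hℓ hs hK hstep hθ hθ1 Metric.isOpen_ball hA'X hA'diam hKr
    fun ε hε _ => (measure_mono (inter_subset_inter_left _ hA'X)).trans (hreg ε hε)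
  -- The initial boundary contributes a quarter of the mass for large k, and the choice of δ bounds
  -- the stationary term by another quarter.
  have hev : ∀ᶠ k : ℕ in atTop, (θ ^ k * Kr + distortionFactor lam α D ℓ * K * volume.real A' /
      (1 - θ)) * δ ≤ volume.real A' / 2 := by
    have hlim : Tendsto (fun k : ℕ => θ ^ k * (Kr * δ)) atTop (𝓝 (0 * (Kr * δ))) :=
      (tendsto_pow_atTop_nhds_zero_of_lt_one hθ0.le hθ1).mul_const _
    rw [zero_mul] at hlim
    filter_upwards [hlim.eventually_le_const (show 0 < volume.real A' / 4 by positivity)] with k hk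
    have h1 := mul_le_mul_of_nonneg_right hδK hA'real.le
    calc _ = θ ^ k * (Kr * δ) +
          distortionFactor lam α D ℓ * K / (1 - θ) * δ * volume.real A' := by ring
      _ ≤ _ := by linarith
  have hGm : ∀ k, MeasurableSet (A ∩ T^[k] ⁻¹' ⋃ j ∈ {j | Reaches T P A (B j)}, B j) := fun k =>
    hA.measurableSet.inter (hS.measurable_iterate k
      (isOpen_biUnion fun j _ => hB j).measurableSet)
  refine lt_of_lt_of_le (ENNReal.half_pos hA'pos.ne') (le_measure_frequently hGm
    (hS.bounded.subset hAX).measure_lt_top.ne (fun k => inter_subset_left) ?_)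
  have htend : Tendsto (fun k : ℕ => k * n) atTop atTop :=
    tendsto_id.atTop_mul_const' (by omega)
  refine htend.frequently ((hev.and (eventually_ge_atTop 1)).mono fun k hk => ?_).frequently
  obtain ⟨hk, hk1⟩ := hk
  obtain ⟨F, hF, hFn, hFbd⟩ := hiter k
  have hsmall : F.boundaryMass T δ ≤ volume A' / 2 := by
    refine (hFbd δ hδ hδ2).trans ((ENNReal.ofReal_le_ofReal hk).trans_eq ?_)
    rw [ENNReal.ofReal_div_of_pos two_pos, Measure.real, ENNReal.ofReal_toReal hA'fin]
    simp
  have hsub : A' ⊆ (A ∩ T^[k * n] ⁻¹' ⋃ j ∈ {j | Reaches T P A (B j)}, B j) ∪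
      ((A' \ (∅ ∪ ⋃ i, F.W i)) ∪
        ⋃ i, F.W i ∩ T^[F.n i] ⁻¹' innerBoundary δ (T^[F.n i] '' F.W i)) := by
    intro x hx
    by_cases hxF : x ∈ ∅ ∪ ⋃ i, F.W i
    · rw [empty_union] at hxF
      obtain ⟨i, hi⟩ := mem_iUnion.1 hxF
      by_cases hxb : T^[F.n i] x ∈ innerBoundary δ (T^[F.n i] '' F.W i)
      · exact Or.inr (Or.inr (mem_iUnion.2 ⟨i, hi, hxb⟩))
      have hIX := (hF.domain i).image_subset hS ((hF.subset i).trans hA'X)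
      have hball := ball_subset_of_notMem_innerBoundary ((hF.domain i).isOpen_image hS)
        (mem_image_of_mem _ hi) hδ hxb
      obtain ⟨j, hj, hjb⟩ := hcov _ (hIX (mem_image_of_mem _ hi))
      refine Or.inl ⟨hA'A hx, mem_biUnion (x := j) ?_ (hFn i ▸ hj)⟩
      refine Reaches.of_subset hS (A' := T^[F.n i] '' F.W i) ⟨F.n i, ?_, F.W i,
        (hF.subset i).trans hA'A, hF.domain i, rfl⟩ (hjb.trans hball) (hB j)
      rw [hFn]
      exact Nat.mul_pos hk1 hn
    · exact Or.inr (Or.inl ⟨hx, hxF⟩)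
  have hle : volume A' ≤ volume (A ∩ T^[k * n] ⁻¹' ⋃ j ∈ {j | Reaches T P A (B j)}, B j) +
      volume A' / 2 := by
    refine (measure_mono hsub).trans ((measure_union_le _ _).trans (add_le_add le_rfl ?_))
    refine (measure_union_le _ _).trans ?_
    rw [hF.cover, zero_add]
    exact (measure_iUnion_le _).trans hsmall
  by_contra! hlt
  have h2 : volume A' / 2 ≠ ∞ := ENNReal.div_ne_top hA'fin two_ne_zero
  have := ENNReal.add_lt_add_right h2 hlt
  rw [ENNReal.add_halves] at this
  exact this.not_ge hle

/-! ### Ergodicity: a cube reached by every open set -/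

/-- By ergodicity, if a set is visited infinitely often with positive probability, then it is
visited infinitely often almost surely. -/
theorem ae_frequently_of_pos (hX : MeasurableSet X) (herg : QuasiErgodic T (volume.restrict X))
    {U : Set (Space d)} (hU : MeasurableSet U)
    (hpos : 0 < volume (X ∩ {x | ∃ᶠ k in atTop, T^[k] x ∈ U})) :
    ∀ᵐ x ∂volume.restrict X, ∃ᶠ k in atTop, T^[k] x ∈ U := by
  set E := {x | ∃ᶠ k in atTop, T^[k] x ∈ U} with hE
  have hEm : MeasurableSet E := by
    have : E = ⋂ N : ℕ, ⋃ n ≥ N, T^[n] ⁻¹' U := by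
      ext x
      simp [hE, frequently_atTop]
    rw [this]
    exact MeasurableSet.iInter fun N => MeasurableSet.iUnion fun n => MeasurableSet.iUnion fun _ =>
      herg.measurable.iterate n hU
  have hinv : T ⁻¹' E = E := by
    ext x
    simp only [hE, mem_preimage, mem_ofPred_eq, ← Function.iterate_succ_apply]
    conv_rhs => rw [← map_add_atTop_eq_nat 1, frequently_map]
  rcases herg.toPreErgodic.ae_mem_or_ae_notMem hEm hinv with h | h
  · exact h
  · rw [ae_iff] at h
    simp only [not_not] at h
    rw [Measure.restrict_apply' hX, inter_comm] at h
    exact absurd h hpos.ne'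

/-- An open set reaches an open subset of any open set visited by almost all orbits. -/
theorem exists_reaches_of_ae_frequently (hS : IsExpandingSystem T X P lam ε₁ α D)
    {U A : Set (Space d)} (hU : IsOpen U)
    (hfreq : ∀ᵐ x ∂volume.restrict X, ∃ᶠ k in atTop, T^[k] x ∈ U) (hA : IsOpen A)
    (hne : A.Nonempty) (hAX : A ⊆ X) :
    ∃ A' ⊆ U ∩ X, IsOpen A' ∧ A'.Nonempty ∧ Reaches T P A A' := by
  have hAvol : volume.restrict X A ≠ 0 := by
    rw [Measure.restrict_apply hA.measurableSet, inter_eq_left.2 hAX]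
    exact (hA.measure_pos _ hne).ne'
  have hex : ∃ x ∈ A, (∀ k, T^[k] x ∈ ⋃₀ P) ∧ ∃ᶠ k in atTop, T^[k] x ∈ U := by
    by_contra! h
    refine hAvol (measure_mono_null (fun x hx => ?_) (ae_iff.1 (hS.ae_iterate_mem.and hfreq)))
    exact fun h' => h'.2 (h x hx h'.1)
  obtain ⟨x, hx, hxP, hxU⟩ := hex
  obtain ⟨k, hk, hkU⟩ := frequently_atTop.1 hxU 1
  choose O hO hxO using hxP
  have hw := cylinder_isBranchDomain hS (n := k) fun i => ⟨O i, hO i⟩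
  have hV := (hw.mono (hw.isOpen.inter hA) inter_subset_left).inter_preimage hS hU
  set V := cylinder T (fun i : Fin k => (⟨O i, hO i⟩ : P)) ∩ A ∩ T^[k] ⁻¹' U
  have hVA : V ⊆ A := inter_subset_left.trans inter_subset_right
  refine ⟨T^[k] '' V, subset_inter ?_ (hV.image_subset hS (hVA.trans hAX)), hV.isOpen_image hS,
    ⟨_, x, ⟨⟨fun i => hxO i, hx⟩, hkU⟩, rfl⟩, k, hk, V, hVA, hV, rfl⟩
  rintro _ ⟨y, hy, rfl⟩
  exact hy.2

/-- Some template is reached by every open set. -/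
theorem exists_common_template (hS : IsExpandingSystem T X P lam ε₁ α D)
    (herg : QuasiErgodic T (volume.restrict X)) (hXpos : 0 < volume X)
    {ι : Type*} [Finite ι] {B : ι → Set (Space d)} (hB : ∀ j, IsOpen (B j))
    (hgrow : ∀ A : Set (Space d), IsOpen A → A.Nonempty → A ⊆ X →
      0 < volume {x | ∃ᶠ k in atTop, x ∈ A ∩ T^[k] ⁻¹' ⋃ j ∈ {j | Reaches T P A (B j)}, B j}) :
    ∃ j, (B j).Nonempty ∧ B j ⊆ X ∧
      ∀ A : Set (Space d), IsOpen A → A.Nonempty → A ⊆ X → Reaches T P A (B j) := by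
  let R : Set (Space d) → Set ι := fun A => {j | Reaches T P A (B j) ∧ (B j).Nonempty}
  have hRX : ∀ A : Set (Space d), A ⊆ X → ∀ j ∈ R A, B j ⊆ X := by
    rintro A hA j ⟨⟨t, -, V, hVA, hV, h⟩, -⟩
    rw [← h]
    exact hV.image_subset hS (hVA.trans hA)
  have hgrow' : ∀ A : Set (Space d), IsOpen A → A.Nonempty → A ⊆ X →
      0 < volume (X ∩ {x | ∃ᶠ k in atTop, T^[k] x ∈ ⋃ j ∈ R A, B j}) := by
    intro A hA hne hAX
    refine (hgrow A hA hne hAX).trans_le (measure_mono fun x hx => ⟨?_, ?_⟩)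
    · obtain ⟨k, hk⟩ := hx.exists
      exact hAX hk.1
    · refine hx.mono fun k hk => ?_
      obtain ⟨j, hj, hkj⟩ := mem_iUnion₂.1 hk.2
      exact mem_iUnion₂.2 ⟨j, ⟨hj, _, hkj⟩, hkj⟩
  have hRne : ∀ A : Set (Space d), IsOpen A → A.Nonempty → A ⊆ X → (R A).Nonempty := by
    intro A hA hne hAX
    obtain ⟨x, hx⟩ := nonempty_of_measure_ne_zero (hgrow' A hA hne hAX).ne'
    obtain ⟨k, hk⟩ := hx.2.exists
    obtain ⟨j, hj, -⟩ := mem_iUnion₂.1 hk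
    exact ⟨j, hj⟩
  have hRtrans : ∀ A : Set (Space d), ∀ i ∈ R A, R (B i) ⊆ R A := fun A i hi j hj =>
    ⟨hi.1.trans hS hj.1, hj.2⟩
  obtain ⟨O, hO⟩ : P.Nonempty := by
    by_contra! h
    have := hS.invertible.partition.cover
    rw [h, sUnion_empty, sdiff_empty] at this
    exact hXpos.ne' this
  have hpart := hS.invertible.partition
  obtain ⟨j₁, hj₁⟩ := hRne O (hpart.isOpen O hO) (hpart.nonempty O hO) (hpart.subset O hO)
  have hne : {j | (B j).Nonempty ∧ B j ⊆ X}.Nonempty :=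
    ⟨j₁, hj₁.2, hRX O (hpart.subset O hO) j₁ hj₁⟩
  -- Following a reached template can only shrink the set of templates reached afterwards. Starting
  -- from a template for which this set is smallest, every reached template reaches exactly the same
  -- ones, so they all reach each other.
  obtain ⟨j₀, ⟨hj₀, hj₀X⟩, hmin⟩ := exists_min_image _ (fun j => (R (B j)).ncard)
    (toFinite {j | (B j).Nonempty ∧ B j ⊆ X}) hne
  obtain ⟨j, hj⟩ := hRne (B j₀) (hB j₀) hj₀ hj₀X
  have hclass : ∀ i ∈ R (B j₀), R (B i) = R (B j₀) := fun i hi =>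
    eq_of_subset_of_ncard_le (hRtrans _ i hi) (hmin i ⟨hi.2, hRX _ hj₀X i hi⟩) (toFinite _)
  refine ⟨j, hj.2, hRX _ hj₀X j hj, fun A hA hne hAX => ?_⟩
  -- Almost every orbit visits this recurrent class infinitely often, so A reaches an open part of
  -- some `B i` in it. That part reaches some `B k` with k in the class, and `B k` reaches `B j`.
  have hopen : IsOpen (⋃ i ∈ R (B j₀), B i) := isOpen_biUnion fun i _ => hB i
  obtain ⟨A', hA'sub, hA', hA'ne, hAA'⟩ := exists_reaches_of_ae_frequently hS hopen
    (ae_frequently_of_pos hS.measurableSet herg hopen.measurableSet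
      (hgrow' (B j₀) (hB j₀) hj₀ hj₀X)) hA hne hAX
  obtain ⟨x, hx⟩ := hA'ne
  obtain ⟨i, hi, hxi⟩ := mem_iUnion₂.1 (hA'sub hx).1
  have hAi : IsOpen (A' ∩ B i) := hA'.inter (hB i)
  obtain ⟨k, hk⟩ := hRne (A' ∩ B i) hAi ⟨x, hx, hxi⟩ (inter_subset_right.trans (hRX _ hj₀X i hi))
  have hkR : k ∈ R (B j₀) := by
    rw [← hclass i hi]
    exact ⟨hk.1.mono inter_subset_right, hk.2⟩
  have hkj : j ∈ R (B k) := by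
    rw [hclass k hkR]
    exact hj
  exact (hAA'.trans hS (hk.1.mono inter_subset_left)).trans hS hkj.1

theorem openCube_eq {a : Space d} {r : ℝ} (hr : 0 < r) :
    openCube a r = {x | dist (WithLp.ofLp x) (WithLp.ofLp a) < r} := by
  ext x
  simp [openCube, dist_pi_lt_iff hr, Real.dist_eq]

/-- Cubes are sublevel sets of the sup distance, which the Euclidean distance dominates; their
radius can therefore be selected by `exists_regular_sublevel`. -/
theorem lipschitzWith_dist_ofLp (a : Space d) :
    LipschitzWith 1 fun x : Space d => dist (WithLp.ofLp x) (WithLp.ofLp a) := by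
  have := (LipschitzWith.dist_left (WithLp.ofLp a)).comp
    (PiLp.lipschitzWith_ofLp 2 fun _ : Fin d => ℝ)
  rwa [one_mul] at this

/-- There is a small cube in `U ∩ X`, with regular boundary, that is reached by every open set. -/
theorem exists_target_cube (hS : IsExpandingSystem T X P lam ε₁ α D)
    (herg : QuasiErgodic T (volume.restrict X)) (hXpos : 0 < volume X)
    {ι : Type*} [Finite ι] {B : ι → Set (Space d)} (hB : ∀ j, IsOpen (B j))
    (hgrow : ∀ A : Set (Space d), IsOpen A → A.Nonempty → A ⊆ X →
      0 < volume {x | ∃ᶠ k in atTop, x ∈ A ∩ T^[k] ⁻¹' ⋃ j ∈ {j | Reaches T P A (B j)}, B j})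
    {U : Set (Space d)} (hU : IsOpen U) (hrec : 0 < volume (recurrentPart T X U))
    {η : ℝ} (hη : 0 < η) :
    ∃ (a : Space d) (r : ℝ), 0 < r ∧ IsOpen (openCube a r) ∧ a ∈ openCube a r ∧
      openCube a r ⊆ U ∩ X ∧ openCube a r ⊆ Metric.ball a η ∧
      (∃ K : ℝ, 0 ≤ K ∧ ∀ ε > 0,
        volume (X ∩ Metric.thickening ε (frontier (openCube a r))) ≤ ENNReal.ofReal (K * ε)) ∧
      ∀ A : Set (Space d), IsOpen A → A.Nonempty → A ⊆ X → Reaches T P A (openCube a r) := by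
  obtain ⟨j, hjne, hjX, hj⟩ := exists_common_template hS herg hXpos hB hgrow
  obtain ⟨A', hA'sub, hA', ⟨a, ha⟩, hjA'⟩ := exists_reaches_of_ae_frequently hS hU
    (ae_frequently_of_pos hS.measurableSet herg hU.measurableSet (hrec.trans_le
      (measure_mono fun x hx => ⟨hx.1.1, hx.2⟩))) (hB j) hjne hjX
  have hopen : IsOpen (WithLp.toLp 2 ⁻¹' (A' ∩ Metric.ball a η) : Set (Fin d → ℝ)) :=
    (hA'.inter Metric.isOpen_ball).preimage (PiLp.continuous_toLp 2 _)
  obtain ⟨ρ, hρ, hρA⟩ := Metric.isOpen_iff.1 hopen (WithLp.ofLp a)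
    ⟨ha, Metric.mem_ball_self hη⟩
  obtain ⟨r, hr, K, hK, hreg⟩ := hS.exists_regular_sublevel (lipschitzWith_dist_ofLp a) hρ
  have hsub : openCube a r ⊆ A' ∩ Metric.ball a η := by
    rw [openCube_eq hr.1]
    exact fun x hx => hρA (show WithLp.ofLp x ∈ _ from (show dist _ _ < r from hx).trans hr.2)
  have hZ : IsOpen (openCube a r) := by
    rw [openCube_eq hr.1]
    exact isOpen_lt (lipschitzWith_dist_ofLp a).continuous continuous_const
  refine ⟨a, r, hr.1, hZ, ?_, (hsub.trans inter_subset_left).trans hA'sub,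
    hsub.trans inter_subset_right, ⟨K, hK, ?_⟩, fun A hA hne hAX => ?_⟩
  · exact fun i => by simpa using hr.1
  · rwa [openCube_eq hr.1]
  · exact (hj A hA hne hAX).trans hS (hjA'.of_subset hS (hsub.trans inter_subset_left) hZ)

/-! ### Removing a set that is mapped onto the target -/

/-- The frontier of `B` carries little mass of `X`, at all scales. -/
def HasRegularFrontier (X B : Set (Space d)) : Prop :=
  ∃ K : ℝ, 0 ≤ K ∧ ∀ ε > 0, volume (X ∩ Metric.thickening ε (frontier B)) ≤ ENNReal.ofReal (K * ε)

theorem HasRegularFrontier.volume_frontier {X B : Set (Space d)} (h : HasRegularFrontier X B) :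
    volume (X ∩ frontier B) = 0 := by
  obtain ⟨K, -, hK⟩ := h
  have hlim : Tendsto (fun k : ℕ => ENNReal.ofReal (K * (1 / ((k : ℝ) + 1)))) atTop
      (𝓝 (ENNReal.ofReal (K * 0))) :=
    ENNReal.tendsto_ofReal (tendsto_one_div_add_atTop_nhds_zero_nat.const_mul K)
  rw [mul_zero, ENNReal.ofReal_zero] at hlim
  refine le_antisymm (ge_of_tendsto' hlim fun k => ?_) zero_le
  exact (measure_mono (inter_subset_inter_right _
    (Metric.self_subset_thickening Nat.one_div_pos_of_nat _))).trans (hK _ Nat.one_div_pos_of_nat)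

theorem innerBoundary_diff_closure_subset {I B : Set (Space d)} (hIX : I ⊆ X) {ε : ℝ} :
    innerBoundary ε (I \ closure B) ⊆
      innerBoundary ε I ∪ X ∩ Metric.thickening ε (frontier B) := by
  intro x hx
  have hx' : x ∈ innerBoundary ε (I ∩ (closure B)ᶜ) := hx
  rcases innerBoundary_inter_subset hx' with h | h
  · exact Or.inl h
  · refine Or.inr ⟨hIX hx.1.1, Metric.thickening_subset_of_subset _ ?_ h.2⟩
    rw [frontier_compl]
    exact frontier_closure_subset

namespace Family

/-- The union of two families. -/
def sum (F G : Family d) : Family d where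
  ι := F.ι ⊕ G.ι
  countable := inferInstance
  W := Sum.elim F.W G.W
  n := Sum.elim F.n G.n

theorem boundaryMass_sum (F G : Family d) (ε : ℝ) :
    (F.sum G).boundaryMass T ε = F.boundaryMass T ε + G.boundaryMass T ε :=
  Summable.tsum_sum (f := fun i : F.ι ⊕ G.ι => volume ((F.sum G).W i ∩
    T^[(F.sum G).n i] ⁻¹' innerBoundary ε (T^[(F.sum G).n i] '' (F.sum G).W i)))
    ENNReal.summable ENNReal.summable

end Family

theorem IsDecomposition.sum {ℓ : ℝ} {F G : Family d} {I A A' R : Set (Space d)}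
    (hF : IsDecomposition T P ℓ F A ∅) (hG : IsDecomposition T P ℓ G A' R) (hRA : R ⊆ A')
    (hA : A ⊆ I) (hA' : A' ⊆ I) (hdisj : Disjoint A A') (hI : volume (I \ (A ∪ A')) = 0) :
    IsDecomposition T P ℓ (F.sum G) I R where
  domain := by
    rintro (i | i)
    exacts [hF.domain i, hG.domain i]
  subset := by
    rintro (i | i)
    exacts [(hF.subset i).trans hA, (hG.subset i).trans hA']
  disjoint_hole := by
    rintro (i | i)
    exacts [hdisj.mono (hF.subset i) hRA, hG.disjoint_hole i]
  disjoint := by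
    rintro (i | i) (j | j) hij
    · exact hF.disjoint fun h => hij (by rw [h])
    · exact hdisj.mono (hF.subset i) (hG.subset j)
    · exact (hdisj.mono (hF.subset j) (hG.subset i)).symm
    · exact hG.disjoint fun h => hij (by rw [h])
  diam_le := by
    rintro (i | i)
    exacts [hF.diam_le i, hG.diam_le i]
  cover := by
    refine measure_mono_null (fun x hx => ?_)
      (measure_union_null hI (measure_union_null hF.cover hG.cover))
    by_cases h : x ∈ A ∪ A'
    · right
      rcases h with h | h
      · refine Or.inl ⟨h, ?_⟩
        rw [empty_union]
        intro h'
        obtain ⟨i, hi⟩ := mem_iUnion.1 h'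
        exact hx.2 (Or.inr (mem_iUnion.2 ⟨Sum.inl i, hi⟩))
      · refine Or.inr ⟨h, ?_⟩
        rintro (h' | h')
        · exact hx.2 (Or.inl h')
        · obtain ⟨i, hi⟩ := mem_iUnion.1 h'
          exact hx.2 (Or.inr (mem_iUnion.2 ⟨Sum.inr i, hi⟩))
    · exact Or.inl ⟨hx.1, h⟩

/-- If a branch maps a subset `V` of `I` onto `Z`, then `I \ V` can be decomposed, with bounded
times, in such a way that the boundary mass is controlled. -/
theorem exists_return_decomposition (hS : IsExpandingSystem T X P lam ε₁ α D) {ℓ ε₂ s K : ℝ}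
    (hℓ : ℓ ≤ ε₁) (hℓ0 : 0 < ℓ) (hs : 0 ≤ s) (hK : 0 ≤ K) (hstep : HasStep T X P lam ℓ ε₂ 1 s K)
    {Z : Set (Space d)} (hZne : Z.Nonempty) (hZX : Z ⊆ X)
    (hZdiam : ∀ x ∈ Z, ∀ y ∈ Z, dist x y ≤ ℓ / 32) (hZreg : HasRegularFrontier X Z)
    (t : ℕ) {I V : Set (Space d)} (hI : IsOpen I) (hIX : I ⊆ X) (hdiam : Metric.diam I ≤ ℓ)
    (hbd : ∃ B : ℝ, 0 ≤ B ∧ ∀ ε, 0 < ε → ε < ε₂ →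
      volume (innerBoundary ε I) ≤ ENNReal.ofReal (B * ε))
    (hVI : V ⊆ I) (hV : IsBranchDomain T P t V) (hVZ : T^[t] '' V = Z) :
    ∃ (F : Family d) (N : ℕ) (B : ℝ), IsDecomposition T P ℓ F I V ∧ (∀ i, F.n i ≤ N) ∧ 0 ≤ B ∧
      ∀ ε, 0 < ε → ε < ε₂ → F.boundaryMass T ε ≤ ENNReal.ofReal (B * ε) := by
  have hlam := hS.lam_pos
  induction t generalizing I V with
  | zero =>
    obtain rfl : V = Z := by simpa using hVZ
    obtain ⟨B, hB, hB'⟩ := hbd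
    obtain ⟨K', hK', hreg⟩ := hZreg
    have hopen : IsOpen (I \ closure V) := hI.sdiff isClosed_closure
    have hdec := isDecomposition_single (T := T) (P := P) hopen
      ((Metric.diam_mono sdiff_subset (hS.bounded.subset hIX)).trans hdiam)
    refine ⟨Family.single (I \ closure V), 0, B + K', ⟨hdec.domain,
      fun _ => sdiff_subset, fun _ => disjoint_sdiff_left.mono_right subset_closure, hdec.disjoint,
      hdec.diam_le, ?_⟩, fun _ => le_rfl, by positivity, fun ε hε hε2 => ?_⟩
    · refine measure_mono_null (fun x hx => ?_)
        (HasRegularFrontier.volume_frontier ⟨K', hK', hreg⟩)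
      refine ⟨hIX hx.1, ?_⟩
      rw [hV.isOpen.frontier_eq]
      by_contra h
      refine hx.2 (or_iff_not_imp_left.2 fun hxV => mem_iUnion.2 ⟨(), hx.1, fun hc => h ⟨hc, hxV⟩⟩)
    · rw [boundaryMass_single, add_mul, ENNReal.ofReal_add (by positivity) (by positivity)]
      exact ((measure_mono (innerBoundary_diff_closure_subset hIX)).trans
        (measure_union_le _ _)).trans (add_le_add (hB' ε hε hε2) (hreg ε hε))
  | succ t ih =>
    obtain ⟨B, hB, hB'⟩ := hbd
    have hVne : V.Nonempty := by
      rw [← hVZ] at hZne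
      exact hZne.of_image
    obtain ⟨v, hv⟩ := hVne
    have hV1 : IsBranchDomain T P 1 V := hV.of_le (Nat.le_add_left 1 t)
    have hTV := hV.image hS
    have hTVZ : T^[t] '' (T '' V) = Z := by rw [← hVZ, ← image_comp]; rfl
    obtain ⟨F₀, hF₀, hF₀n, hF₀bd, hF₀V⟩ := hstep I hI hIX hdiam (T v)
    -- The remaining t iterates send TV onto Z, so contraction bounds the diameter of TV by that of
    -- Z, at most ℓ/32. It therefore lies in one cell and V is not cut.
    obtain ⟨i₀, hi₀⟩ := hF₀V V hVI hV1 ⟨v, hv⟩ (by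
      rintro _ ⟨u, hu, rfl⟩
      have hmem : ∀ w ∈ V, T^[t] (T w) ∈ Z := fun w hw =>
        hTVZ ▸ mem_image_of_mem _ (mem_image_of_mem _ hw)
      have h1 := hZdiam _ (hmem u hu) _ (hmem v hv)
      refine (hTV.dist_le hS (mem_image_of_mem T hu) (mem_image_of_mem T hv)
        (h1.trans (by linarith))).trans (le_trans ?_ h1)
      exact mul_le_of_le_one_left dist_nonneg (pow_le_one₀ hlam.le hS.lam_lt_one.le))
      (by simpa using hV1.image_subset hS (hVI.trans hIX) (mem_image_of_mem _ hv))
    have hIfin : volume I ≠ ∞ := (hS.bounded.subset hIX).measure_lt_top.ne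
    set B₀ := (1 + s) * (B * lam) + K * volume.real I with hB₀
    have hB₀0 : 0 ≤ B₀ := by positivity
    have hbd₀ : ∀ ε, 0 < ε → ε < ε₂ → F₀.boundaryMass T ε ≤ ENNReal.ofReal (B₀ * ε) := by
      intro ε hε hε2
      have hle : lam ^ 1 * ε ≤ ε := by
        rw [pow_one]
        exact mul_le_of_le_one_left hε.le hS.lam_lt_one.le
      refine (hF₀bd ε hε hε2).trans ((add_le_add (mul_le_mul_right
        (hB' (lam ^ 1 * ε) (by positivity) (hle.trans_lt hε2)) _) le_rfl).trans_eq ?_)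
      rw [← ENNReal.ofReal_toReal hIfin, ← ENNReal.ofReal_mul (by positivity),
        ← ENNReal.ofReal_mul (by positivity), ← ENNReal.ofReal_add (by positivity) (by positivity),
        hB₀, Measure.real]
      congr 1
      ring
    set J := T^[F₀.n i₀] '' F₀.W i₀ with hJdef
    have hJ : IsOpen J := (hF₀.domain i₀).isOpen_image hS
    have hJX : J ⊆ X := (hF₀.domain i₀).image_subset hS ((hF₀.subset i₀).trans hIX)
    have hTVJ : T '' V ⊆ J := by
      rw [hJdef, hF₀n, Function.iterate_one]
      exact image_mono hi₀
    -- A bound on the boundary mass of the whole family bounds the boundary of the single image J,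
    -- after division by the comparison constant of its branch. This provides the regularity
    -- hypothesis for the induction.
    have hJbd : ∃ B : ℝ, 0 ≤ B ∧ ∀ ε, 0 < ε → ε < ε₂ →
        volume (innerBoundary ε J) ≤ ENNReal.ofReal (B * ε) := by
      obtain ⟨κ, hκ0, hκt, hκ⟩ := (hF₀.domain i₀).exists_comparison hS
        ((hF₀.subset i₀).trans hIX) hℓ (hF₀.diam_le i₀)
      refine ⟨κ.toReal⁻¹ * B₀, by positivity, fun ε hε hε2 => ?_⟩
      have h1 := (hκ _ (isOpen_innerBoundary (ε := ε) hJ).measurableSet innerBoundary_subset).1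
      have h2 : κ * volume (innerBoundary ε J) ≤ ENNReal.ofReal (B₀ * ε) :=
        (h1.trans (ENNReal.le_tsum i₀)).trans (hbd₀ ε hε hε2)
      rw [mul_assoc, ENNReal.ofReal_mul (by positivity), ENNReal.ofReal_inv_of_pos
        (ENNReal.toReal_pos hκ0 hκt), ENNReal.ofReal_toReal hκt]
      rwa [← ENNReal.mul_le_iff_le_inv hκ0 hκt]
    obtain ⟨F₁, N₁, B₁, hF₁, hF₁n, hB₁, hF₁bd⟩ :=
      ih hJ hJX (hF₀.diam_le i₀) hJbd hTVJ hTV hTVZ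
    classical
    -- Only the piece containing V is followed further; every other piece stops here.
    let G : F₀.ι → Family d :=
      Function.update (fun i => Family.single (T^[F₀.n i] '' F₀.W i)) i₀ F₁
    let R : F₀.ι → Set (Space d) := Function.update (fun _ => ∅) i₀ (T '' V)
    have hG0 : G i₀ = F₁ := Function.update_self ..
    have hR0 : R i₀ = T '' V := Function.update_self ..
    have hG1 : ∀ i, i ≠ i₀ → G i = Family.single (T^[F₀.n i] '' F₀.W i) := fun i hi =>
      Function.update_of_ne hi ..
    have hR1 : ∀ i, i ≠ i₀ → R i = ∅ := fun i hi => Function.update_of_ne hi ..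
    have hG : ∀ i, IsDecomposition T P ℓ (G i) (T^[F₀.n i] '' F₀.W i) (R i) := by
      intro i
      by_cases hi : i = i₀
      · subst hi
        rw [hG0, hR0]
        exact hF₁
      · rw [hG1 i hi, hR1 i hi]
        exact isDecomposition_single ((hF₀.domain i).isOpen_image hS) (hF₀.diam_le i)
    have hhole : ∅ ∪ ⋃ i, F₀.W i ∩ T^[F₀.n i] ⁻¹' R i = V := by
      rw [empty_union]
      ext x
      rw [mem_iUnion]
      constructor
      · rintro ⟨i, hxi, hx⟩
        by_cases hi : i = i₀
        · subst hi
          rw [mem_preimage, hR0, hF₀n, Function.iterate_one] at hx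
          obtain ⟨u, hu, hux⟩ := hx
          have hinj := (hF₀.domain i).injOn hS
          rw [hF₀n, Function.iterate_one] at hinj
          exact hinj (hi₀ hu) hxi hux ▸ hu
        · rw [mem_preimage, hR1 i hi] at hx
          exact absurd hx (notMem_empty _)
      · intro hx
        refine ⟨i₀, hi₀ hx, ?_⟩
        rw [mem_preimage, hR0, hF₀n, Function.iterate_one]
        exact mem_image_of_mem T hx
    have hJfin : volume J ≠ ∞ := (hS.bounded.subset hJX).measure_lt_top.ne
    have hJpos : volume J ≠ 0 := (hJ.measure_pos _ ⟨T v, hTVJ (mem_image_of_mem T hv)⟩).ne'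
    have hJreal : 0 < volume.real J := ENNReal.toReal_pos hJpos hJfin
    have hb := distortionFactor_pos lam α D ℓ
    refine ⟨F₀.bind T G, 1 + N₁,
      distortionFactor lam α D ℓ * (B₀ + B₁ / volume.real J * volume.real I), ?_, ?_,
      by positivity, fun ε hε hε2 => ?_⟩
    · have := hF₀.bind hS hIX hG
      rwa [hhole] at this
    · rintro ⟨i, j⟩
      simp only [Family.bind, hF₀n]
      refine Nat.add_le_add_left ?_ 1
      by_cases hi : i = i₀
      · subst hi
        have h : ∀ F' : Family d, F' = F₁ → ∀ j : F'.ι, F'.n j ≤ N₁ := by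
          rintro _ rfl
          exact hF₁n
        exact h _ hG0 j
      · have h : ∀ F' : Family d, F' = Family.single (T^[F₀.n i] '' F₀.W i) →
            ∀ j : F'.ι, F'.n j ≤ N₁ := by
          rintro _ rfl j
          exact Nat.zero_le _
        exact h _ (hG1 i hi) j
    -- Stopped pieces retain their boundary, whence `s = 1` and `ε' = ε`. The bound B₁ε for the
    -- followed piece is written as a multiple of the volume of J to fit the `C` term.
    · have h1 := hF₀.boundaryMass_bind_le hS hℓ hIX hG
        (fun i => by
          by_cases hi : i = i₀
          · subst hi
            rw [hR0]
            exact hTVJ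
          · rw [hR1 i hi]
            exact empty_subset _)
        (fun i => by
          by_cases hi : i = i₀
          · subst hi
            rw [hR0]
            exact hTV.isOpen.measurableSet
          · rw [hR1 i hi]
            exact MeasurableSet.empty)
        (C' := 0) (ε := ε) (ε' := ε) (s := 1)
        (C := ENNReal.ofReal (B₁ / volume.real J * ε))
        fun i => by
          rw [zero_mul, add_zero, one_mul]
          by_cases hi : i = i₀
          · subst hi
            rw [hG0]
            refine le_add_left ((hF₁bd ε hε hε2).trans_eq ?_)
            rw [← hJdef, ← ENNReal.ofReal_toReal hJfin, ← ENNReal.ofReal_mul (by positivity)]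
            congr 1
            rw [Measure.real] at hJreal ⊢
            field_simp
          · rw [hG1 i hi, boundaryMass_single]
            exact le_self_add
      refine h1.trans ?_
      rw [zero_mul, add_zero, one_mul]
      have hAm : ∑' i, volume (F₀.W i) ≤ ENNReal.ofReal (volume.real I) := by
        rw [Measure.real, ENNReal.ofReal_toReal hIfin]
        exact hF₀.measure_le
      refine (mul_le_mul_right (add_le_add (hbd₀ ε hε hε2) (mul_le_mul_right hAm _)) _).trans_eq ?_
      rw [← ENNReal.ofReal_mul (by positivity), ← ENNReal.ofReal_add (by positivity)
        (by positivity), ← ENNReal.ofReal_mul hb.le]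
      congr 1
      ring

/-! ### One step of the inducing procedure -/

/-- The properties of one step `(F, R, t)` of the inducing procedure on the set `I`. -/
structure IsInducingStep (T : Space d → Space d) (P : Set (Set (Space d)))
    (lam ℓ ε₂ s K L C δ : ℝ) (n N : ℕ) (Z I : Set (Space d)) (F : Family d) (R : Set (Space d))
    (t : ℕ) : Prop where
  decomp : IsDecomposition T P ℓ F I R
  time_le : ∀ i, F.n i ≤ N
  isOpen : IsOpen R
  subset : R ⊆ I
  one_le : 1 ≤ t
  le : t ≤ N
  onto : R.Nonempty → IsBranchDomain T P t R ∧ T^[t] '' R = Z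
  measure_le : volume (I \ innerBoundary δ I) ≤ ENNReal.ofReal L * volume R
  boundaryMass_le : ∀ ε, 0 < ε → ε < ε₂ → F.boundaryMass T ε ≤
    ENNReal.ofReal (1 + s) * volume (innerBoundary (lam ^ n * ε) I) +
      ENNReal.ofReal (K * ε) * volume I + ENNReal.ofReal (C * ε) * volume R

/-- One step of the inducing procedure: a small open set `I` is decomposed, with bounded times,
into pieces with controlled boundary mass and a part `R` that is mapped onto `Z` by a branch; if
`I` is not contained in its inner `δ`-boundary then `R` is not too small. -/
theorem exists_inducing_step (hS : IsExpandingSystem T X P lam ε₁ α D) {ℓ ε₂ s K s' K' δ : ℝ}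
    {n : ℕ} (hℓ : ℓ ≤ ε₁) (hℓ0 : 0 < ℓ) (hs : 0 ≤ s)
    (hstep : HasStep T X P lam ℓ ε₂ n s K) (hs' : 0 ≤ s') (hK' : 0 ≤ K')
    (hstep' : HasStep T X P lam ℓ ε₂ 1 s' K')
    {Z : Set (Space d)} (hZne : Z.Nonempty) (hZX : Z ⊆ X)
    (hZdiam : ∀ x ∈ Z, ∀ y ∈ Z, dist x y ≤ ℓ / 32) (hZreg : HasRegularFrontier X Z)
    (hδ : 0 < δ) {ι : Type*} [Finite ι] {B : ι → Set (Space d)} (hB : ∀ j, IsOpen (B j))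
    (hBdiam : ∀ j, Metric.diam (B j) ≤ ℓ) (hBreg : ∀ j, HasRegularFrontier X (B j))
    (hcov : ∀ x ∈ X, ∃ j, x ∈ B j ∧ B j ⊆ Metric.ball x δ)
    (hreach : ∀ A : Set (Space d), IsOpen A → A.Nonempty → A ⊆ X → Reaches T P A Z) :
    ∃ (L C : ℝ) (N : ℕ), 0 ≤ L ∧ 0 ≤ C ∧ 1 ≤ N ∧
      ∀ I : Set (Space d), IsOpen I → I ⊆ X → Metric.diam I ≤ ℓ →
        ∃ (F : Family d) (R : Set (Space d)) (t : ℕ),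
          IsInducingStep T P lam ℓ ε₂ s K L C δ n N Z I F R t := by
  have hlam := hS.lam_pos
  -- The returning set and its decomposition are attached to the template, not to I. There are
  -- finitely many templates, so the constants are uniform in I. Templates that are empty or leave X
  -- receive dummy values.
  have key : ∀ j, ∃ (V : Set (Space d)) (t : ℕ) (F : Family d) (N : ℕ) (C : ℝ),
      (B j).Nonempty → B j ⊆ X → 1 ≤ t ∧ V ⊆ B j ∧ IsBranchDomain T P t V ∧ T^[t] '' V = Z ∧
        IsDecomposition T P ℓ F (B j) V ∧ (∀ i, F.n i ≤ N) ∧ 0 ≤ C ∧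
        ∀ ε, 0 < ε → ε < ε₂ → F.boundaryMass T ε ≤ ENNReal.ofReal (C * ε) := by
    intro j
    by_cases h : (B j).Nonempty ∧ B j ⊆ X
    · obtain ⟨t, ht, V, hVB, hV, hVZ⟩ := hreach (B j) (hB j) h.1 h.2
      obtain ⟨Kj, hKj, hreg⟩ := hBreg j
      obtain ⟨F, N, C, hF, hFn, hC, hFbd⟩ := exists_return_decomposition hS hℓ hℓ0 hs' hK' hstep'
        hZne hZX hZdiam hZreg t (hB j) h.2 (hBdiam j)
        ⟨Kj, hKj, fun ε hε _ => (measure_mono (inter_subset_inter_left _ h.2)).trans (hreg ε hε)⟩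
        hVB hV hVZ
      exact ⟨V, t, F, N, C, fun _ _ => ⟨ht, hVB, hV, hVZ, hF, hFn, hC, hFbd⟩⟩
    · exact ⟨∅, 0, Family.single ∅, 0, 0, fun h1 h2 => absurd ⟨h1, h2⟩ h⟩
  choose V t F N C key using key
  choose Kr hKr hreg using hBreg
  obtain ⟨N', hN'⟩ := Finite.exists_le fun j => N j + t j
  obtain ⟨L, hL⟩ := Finite.exists_le fun j => volume.real X / volume.real (V j)
  -- Cutting out the template adds the boundary of `B j` to the evolved part and the decomposition
  -- of the template minus `V j`. Both costs are O(ε), and dividing by the volume of `V j` charges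
  -- them to the returning mass.
  obtain ⟨C', hC'⟩ := Finite.exists_le fun j =>
    ((1 + s) * (Kr j * lam ^ n) + C j) / volume.real (V j)
  refine ⟨max L 0, max C' 0, max (N' + n) 1, le_max_right _ _, le_max_right _ _, le_max_right _ _,
    fun I hI hIX hdiam => ?_⟩
  rcases eq_empty_or_nonempty (I \ innerBoundary δ I) with hshort | ⟨x, hxI, hxb⟩
  · obtain ⟨F₀, hF₀, hF₀n, hF₀bd, -⟩ := hstep I hI hIX hdiam 0
    refine ⟨F₀, ∅, 1, hF₀, fun i => ?_, isOpen_empty, empty_subset _, le_rfl, le_max_right _ _,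
      fun h => absurd h not_nonempty_empty, ?_, fun ε hε hε2 => ?_⟩
    · rw [hF₀n]
      omega
    · simp [hshort]
    · simpa using hF₀bd ε hε hε2
  obtain ⟨j, hxj, hj⟩ := hcov x (hIX hxI)
  have hjI : B j ⊆ I := hj.trans (ball_subset_of_notMem_innerBoundary hI hxI hδ hxb)
  obtain ⟨ht, hVB, hV, hVZ, hF, hFn, hC, hFbd⟩ := key j ⟨x, hxj⟩ (hjI.trans hIX)
  have hVne : (V j).Nonempty := by
    rw [← hVZ] at hZne
    exact hZne.of_image
  have hVfin : volume (V j) ≠ ∞ :=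
    (hS.bounded.subset (hVB.trans (hjI.trans hIX))).measure_lt_top.ne
  have hVreal : 0 < volume.real (V j) := ENNReal.toReal_pos (hV.isOpen.measure_pos _ hVne).ne' hVfin
  have hI₁ : IsOpen (I \ closure (B j)) := hI.sdiff isClosed_closure
  obtain ⟨F₀, hF₀, hF₀n, hF₀bd, -⟩ := hstep (I \ closure (B j)) hI₁ (sdiff_subset.trans hIX)
    ((Metric.diam_mono sdiff_subset (hS.bounded.subset hIX)).trans hdiam) 0
  have hNj : N j + t j ≤ N' := hN' j
  refine ⟨F₀.sum (F j), V j, t j, hF₀.sum hF hVB sdiff_subset hjI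
    (disjoint_sdiff_left.mono_right subset_closure) ?_, ?_, hV.isOpen, hVB.trans hjI, ht, by omega,
    fun _ => ⟨hV, hVZ⟩, ?_, fun ε hε hε2 => ?_⟩
  · refine measure_mono_null (fun y hy => ?_)
      (HasRegularFrontier.volume_frontier ⟨Kr j, hKr j, hreg j⟩)
    refine ⟨hIX hy.1, ?_⟩
    rw [(hB j).frontier_eq]
    by_contra h
    exact hy.2 (or_iff_not_imp_right.2 fun hyB => ⟨hy.1, fun hc => h ⟨hc, hyB⟩⟩)
  · rintro (i | i)
    · have := hF₀n i
      simp only [Family.sum, Sum.elim_inl]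
      omega
    · have := hFn i
      simp only [Family.sum, Sum.elim_inr]
      omega
  · calc volume (I \ innerBoundary δ I) ≤ volume X := measure_mono (sdiff_subset.trans hIX)
      _ = ENNReal.ofReal (volume.real X / volume.real (V j)) * volume (V j) := by
          rw [← ENNReal.ofReal_toReal hVfin, ← ENNReal.ofReal_mul (by positivity),
            ← Measure.real, div_mul_cancel₀ _ hVreal.ne', Measure.real,
            ENNReal.ofReal_toReal hS.volume_lt_top.ne]
      _ ≤ _ := by
          gcongr
          exact (hL j).trans (le_max_left _ _)
  · have hle : lam ^ n * ε ≤ ε :=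
      mul_le_of_le_one_left hε.le (pow_le_one₀ hlam.le hS.lam_lt_one.le)
    have hε' : 0 < lam ^ n * ε := by positivity
    rw [Family.boundaryMass_sum]
    have hKrj := hKr j
    calc F₀.boundaryMass T ε + (F j).boundaryMass T ε
        ≤ (ENNReal.ofReal (1 + s) * (volume (innerBoundary (lam ^ n * ε) I) +
            ENNReal.ofReal (Kr j * (lam ^ n * ε))) + ENNReal.ofReal (K * ε) * volume I) +
            ENNReal.ofReal (C j * ε) := by
          refine add_le_add ((hF₀bd ε hε hε2).trans (add_le_add (mul_le_mul_right ?_ _)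
            (mul_le_mul_right (measure_mono sdiff_subset) _))) (hFbd ε hε hε2)
          exact (measure_mono (innerBoundary_diff_closure_subset hIX)).trans
            ((measure_union_le _ _).trans (add_le_add le_rfl (hreg j _ hε')))
      _ = ENNReal.ofReal (1 + s) * volume (innerBoundary (lam ^ n * ε) I) +
            ENNReal.ofReal (K * ε) * volume I +
            ENNReal.ofReal (((1 + s) * (Kr j * lam ^ n) + C j) / volume.real (V j) * ε) *
              volume (V j) := by
          have h1 : ENNReal.ofReal (((1 + s) * (Kr j * lam ^ n) + C j) / volume.real (V j) * ε) *
              volume (V j) = ENNReal.ofReal (1 + s) * ENNReal.ofReal (Kr j * (lam ^ n * ε)) +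
                ENNReal.ofReal (C j * ε) := by
            rw [← ENNReal.ofReal_toReal hVfin, ← ENNReal.ofReal_mul (by positivity),
              ← ENNReal.ofReal_mul (by positivity),
              ← ENNReal.ofReal_add (by positivity) (by positivity), ← Measure.real]
            congr 1
            field_simp
          rw [h1]
          ring
      _ ≤ _ := by
          gcongr
          exact (hC' j).trans (le_max_left _ _)

/-! ### Exponential decay of the remaining mass -/

/-- A potential that contracts along the inducing procedure. -/
theorem exists_contracting_potential {θ b₁ b₂ δ L : ℝ} (hθ0 : 0 ≤ θ) (hθ : θ < 1)
    (hb₁ : 0 ≤ b₁) (hb₂ : 0 ≤ b₂) (hδ : 0 ≤ δ) (hL : 0 ≤ L) (hsmall : b₁ * δ ≤ (1 - θ) / 2) :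
    ∃ η κ : ℝ, 0 < η ∧ 0 < κ ∧ κ < 1 ∧ ∀ M M' B h : ℝ, 0 ≤ M → 0 ≤ B → 0 ≤ h →
      M' + h ≤ M → M ≤ δ * B + L * h →
      M' + η * (θ * B + b₁ * M + b₂ * h) ≤ κ * (M + η * B) := by
  set c := b₁ * L + b₂
  have hc : 0 ≤ c := by positivity
  -- With this η, the boundary created by the returning mass h costs at most h/2 in the potential,
  -- half of what M loses.
  set η := 1 / (2 * (c + 1)) with hη
  have hη0 : 0 < η := by positivity
  have hηc : η * c ≤ 1 / 2 := by
    rw [hη, one_div_mul_eq_div, div_le_div_iff₀ (by positivity) two_pos]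
    linarith
  have hθ' : 0 < 1 - θ := sub_pos.2 hθ
  -- The other half of h, with a part of the contraction of B, pays for a fraction u of M: uM ≤ η(1
  -- - θ)B/4 + h/2.
  set u := min (1 / (2 * (L + 1))) (η * (1 - θ) / (4 * (δ + 1)))
  have hu0 : 0 < u := lt_min (by positivity) (by positivity)
  have hu1 : u * L ≤ 1 / 2 := by
    have h1 : u * (L + 1) ≤ 1 / 2 := by
      have := (le_div_iff₀ (by positivity)).1 (min_le_left (1 / (2 * (L + 1)))
        (η * (1 - θ) / (4 * (δ + 1))))
      linarith
    nlinarith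
  have hu2 : u * δ ≤ η * (1 - θ) / 4 := by
    have := (le_div_iff₀ (by positivity)).1 (min_le_right (1 / (2 * (L + 1)))
      (η * (1 - θ) / (4 * (δ + 1))))
    nlinarith
  refine ⟨η, max (1 - u) ((3 + θ) / 4), hη0, lt_max_of_lt_right (by linarith),
    max_lt (by linarith) (by linarith), fun M M' B h hM hB hh hMM' hMB => ?_⟩
  have h1 : θ * B + b₁ * M + b₂ * h ≤ (1 + θ) / 2 * B + c * h := by
    have h2 := mul_le_mul_of_nonneg_left hMB hb₁
    have h3 := mul_le_mul_of_nonneg_right hsmall hB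
    have h4 : c * h = b₁ * L * h + b₂ * h := by ring
    rw [h4]
    linarith
  have h2 := mul_le_mul_of_nonneg_left h1 hη0.le
  have h3 := mul_le_mul_of_nonneg_right hηc hh
  have h4 := mul_le_mul_of_nonneg_left hMB hu0.le
  have h5 := mul_le_mul_of_nonneg_right hu1 hh
  have h6 := mul_le_mul_of_nonneg_right hu2 hB
  have h7 := mul_le_mul_of_nonneg_right (le_max_left (1 - u) ((3 + θ) / 4)) hM
  have h8 := mul_le_mul_of_nonneg_right (le_max_right (1 - u) ((3 + θ) / 4))
    (mul_nonneg hη0.le hB)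
  linarith

/-- The measure is arbitrary because the bound is applied to push-forwards of Lebesgue measure under
branches, which gives the exact mass balance without any distortion loss. -/
theorem IsDecomposition.tsum_measure_add_le {ℓ : ℝ} {F : Family d} {A R : Set (Space d)}
    (hF : IsDecomposition T P ℓ F A R) (hRA : R ⊆ A) (μ : Measure (Space d)) :
    ∑' i, μ (F.W i) + μ R ≤ μ A := by
  have hm : ∀ i, MeasurableSet (F.W i) := fun i => (hF.domain i).isOpen.measurableSet
  rw [← measure_iUnion hF.disjoint hm, add_comm, ← measure_union
    (disjoint_iUnion_right.2 fun i => (hF.disjoint_hole i).symm) (MeasurableSet.iUnion hm)]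
  exact measure_mono (union_subset hRA (iUnion_subset hF.subset))

/-- The iterated inducing procedure: the parts `R k i` of the images of the pieces of the `k`-th
family are mapped onto `Z`, and the mass of the remaining pieces decays exponentially. -/
theorem exists_inducing_families (hS : IsExpandingSystem T X P lam ε₁ α D)
    {ℓ ε₂ s K L C δ θ : ℝ} {n N : ℕ} (hℓ : ℓ ≤ ε₁) (hs : 0 ≤ s) (hK : 0 ≤ K) (hL : 0 ≤ L)
    (hC : 0 ≤ C) (hδ : 0 < δ) (hδ2 : δ < ε₂)
    (hθ : θ = distortionFactor lam α D ℓ * (1 + s) * lam ^ n) (hθ1 : θ < 1)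
    (hsmall : distortionFactor lam α D ℓ * K * (distortionFactor lam α D ℓ * δ) ≤ (1 - θ) / 2)
    {Z : Set (Space d)} (hZo : IsOpen Z) (hZX : Z ⊆ X) (hZdiam : Metric.diam Z ≤ ℓ)
    (hZreg : HasRegularFrontier X Z)
    (hind : ∀ I : Set (Space d), IsOpen I → I ⊆ X → Metric.diam I ≤ ℓ →
      ∃ (F : Family d) (R : Set (Space d)) (t : ℕ),
        IsInducingStep T P lam ℓ ε₂ s K L C δ n N Z I F R t) :
    ∃ (F : ℕ → Family d) (R : ∀ k, (F k).ι → Set (Space d)) (t : ∀ k, (F k).ι → ℕ) (Φ κ : ℝ),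
      0 ≤ Φ ∧ 0 < κ ∧ κ < 1 ∧
      (∀ k, IsDecomposition T P ℓ (F k) Z
        (⋃ l < k, ⋃ i, (F l).W i ∩ T^[(F l).n i] ⁻¹' R l i)) ∧
      (∀ k i, (F k).n i ≤ k * N) ∧
      (∀ k i, R k i ⊆ T^[(F k).n i] '' (F k).W i ∧ 1 ≤ t k i ∧ t k i ≤ N ∧
        ((R k i).Nonempty → IsBranchDomain T P (t k i) (R k i) ∧ T^[t k i] '' R k i = Z)) ∧
      ∀ k, ∑' i, volume ((F k).W i) ≤ ENNReal.ofReal (Φ * κ ^ k) := by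
  have hlam := hS.lam_pos
  have hb := distortionFactor_pos lam α D ℓ
  set b := distortionFactor lam α D ℓ
  have hθ0 : 0 ≤ θ := by rw [hθ]; positivity
  have hZfin : volume Z ≠ ∞ := (hS.bounded.subset hZX).measure_lt_top.ne
  obtain ⟨η, κ, hη, hκ0, hκ1, hpot⟩ := exists_contracting_potential hθ0 hθ1
    (b₁ := b * K) (b₂ := b * C) (δ := b * δ) (L := b * L) (by positivity) (by positivity)
    (by positivity) (by positivity) hsmall
  obtain ⟨B₀, hB₀, hZbd⟩ := hZreg
  -- The step is extended by dummy values to all sets, so that after `choose` the families can be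
  -- defined by plain recursion before their properties are known.
  have hind' : ∀ I : Set (Space d), ∃ (F : Family d) (R : Set (Space d)) (t : ℕ),
      IsOpen I → I ⊆ X → Metric.diam I ≤ ℓ →
        IsInducingStep T P lam ℓ ε₂ s K L C δ n N Z I F R t := by
    intro I
    by_cases h : IsOpen I ∧ I ⊆ X ∧ Metric.diam I ≤ ℓ
    · obtain ⟨F, R, t, h'⟩ := hind I h.1 h.2.1 h.2.2
      exact ⟨F, R, t, fun _ _ _ => h'⟩
    · exact ⟨Family.single ∅, ∅, 0, fun h1 h2 h3 => absurd ⟨h1, h2, h3⟩ h⟩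
  choose G R t hGRt using hind'
  let F : ℕ → Family d := fun k => Nat.rec (Family.single Z)
    (fun _ F => F.bind T fun i => G (T^[F.n i] '' F.W i)) k
  have hFs : ∀ k, F (k + 1) = (F k).bind T fun i => G (T^[(F k).n i] '' (F k).W i) := fun _ => rfl
  have hstep : ∀ k, ∀ H : Set (Space d), IsDecomposition T P ℓ (F k) Z H → ∀ i,
      IsInducingStep T P lam ℓ ε₂ s K L C δ n N Z (T^[(F k).n i] '' (F k).W i)
        (G (T^[(F k).n i] '' (F k).W i)) (R (T^[(F k).n i] '' (F k).W i))
        (t (T^[(F k).n i] '' (F k).W i)) := fun k H hF i =>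
    hGRt _ ((hF.domain i).isOpen_image hS) ((hF.domain i).image_subset hS
      ((hF.subset i).trans hZX)) (hF.diam_le i)
  have hdec : ∀ k, IsDecomposition T P ℓ (F k) Z (⋃ l < k, ⋃ i, (F l).W i ∩
      T^[(F l).n i] ⁻¹' R (T^[(F l).n i] '' (F l).W i)) := by
    intro k
    induction k with
    | zero =>
      have he : ∀ H : ℕ → Set (Space d), ⋃ l < 0, H l = ∅ := fun H => by simp
      rw [he]
      exact isDecomposition_single hZo hZdiam
    | succ k ih =>
      rw [biUnion_lt_succ, hFs]
      exact ih.bind hS hZX fun i => (hstep k _ ih i).decomp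
  refine ⟨F, fun k i => R (T^[(F k).n i] '' (F k).W i), fun k i => t (T^[(F k).n i] '' (F k).W i),
    volume.real Z + η * B₀, κ, by positivity, hκ0, hκ1, hdec, fun k => ?_, fun k i => ?_, ?_⟩
  · induction k with
    | zero => exact fun _ => Nat.zero_le _
    | succ k ih =>
      rintro ⟨i, j⟩
      have h1 := ih i
      have h2 := (hstep k _ (hdec k) i).time_le j
      calc (F k).n i + (G (T^[(F k).n i] '' (F k).W i)).n j ≤ k * N + N := add_le_add h1 h2
        _ = _ := by ring
  · have h := hstep k _ (hdec k) i
    exact ⟨h.subset, h.one_le, h.le, h.onto⟩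
  have hfin : ∀ k, ∑' i, volume ((F k).W i) ≠ ∞ := fun k =>
    ((hdec k).measure_le.trans_lt hZfin.lt_top).ne
  suffices h : ∀ k, ∃ B : ℝ, 0 ≤ B ∧
      (∀ ε, 0 < ε → ε < ε₂ → (F k).boundaryMass T ε ≤ ENNReal.ofReal (B * ε)) ∧
      (∑' i, volume ((F k).W i)).toReal + η * B ≤ κ ^ k * (volume.real Z + η * B₀) by
    intro k
    obtain ⟨B, hB, -, hBM⟩ := h k
    rw [← ENNReal.ofReal_toReal (hfin k), mul_comm]
    exact ENNReal.ofReal_le_ofReal (le_trans (le_add_of_nonneg_right (by positivity)) hBM)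
  intro k
  induction k with
  | zero =>
    refine ⟨B₀, hB₀, fun ε hε _ => ?_, ?_⟩
    · refine (boundaryMass_single (T := T) (A := Z)).trans_le ?_
      exact (measure_mono (inter_subset_inter_left _ hZX)).trans (hZbd ε hε)
    · rw [pow_zero, one_mul]
      exact add_le_add (ENNReal.toReal_mono hZfin (hdec 0).measure_le) le_rfl
  | succ k ih =>
    obtain ⟨B, hB, hBbd, hBM⟩ := ih
    set M := ∑' i, volume ((F k).W i) with hM
    set I : (F k).ι → Set (Space d) := fun i => T^[(F k).n i] '' (F k).W i with hI
    set h := ∑' i, volume ((F k).W i ∩ T^[(F k).n i] ⁻¹' R (I i)) with hh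
    have hst := hstep k _ (hdec k)
    have hdk := hdec k
    have hmass : ∑' i, volume ((F (k + 1)).W i) + h ≤ M := by
      rw [hFs, hh, hM]
      change ∑' p : Σ i, (G (I i)).ι, volume ((F k).W p.1 ∩ T^[(F k).n p.1] ⁻¹' (G (I p.1)).W p.2) +
        _ ≤ _
      rw [ENNReal.tsum_sigma', ← ENNReal.tsum_add]
      refine ENNReal.tsum_le_tsum fun i => ?_
      have h1 := (hst i).decomp.tsum_measure_add_le (hst i).subset
        ((volume.restrict ((F k).W i)).map T^[(F k).n i])
      have hTm := hS.measurable_iterate ((F k).n i)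
      have h2 : ∀ A, MeasurableSet A → (volume.restrict ((F k).W i)).map T^[(F k).n i] A =
          volume ((F k).W i ∩ T^[(F k).n i] ⁻¹' A) := fun A hA => by
        rw [Measure.map_apply hTm hA, Measure.restrict_apply (hTm hA), inter_comm]
      simp only [h2 _ (((hst i).decomp.domain _).isOpen.measurableSet)] at h1
      rw [h2 _ (hst i).isOpen.measurableSet,
        h2 _ ((hdk.domain i).isOpen_image hS).measurableSet] at h1
      exact h1.trans (measure_mono inter_subset_left)
    have hMfin : M ≠ ∞ := hfin k
    have hhfin : h ≠ ∞ := ((le_add_self.trans hmass).trans_lt (hfin k).lt_top).ne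
    -- Mass in the inner δ-boundaries is bounded by the boundary mass; the rest is at most L times
    -- the returning mass, up to distortion.
    have hlong : M ≤ ENNReal.ofReal (b * δ * B + b * L * h.toReal) := by
      have h1 : M ≤ ENNReal.ofReal b * ((F k).boundaryMass T δ + ENNReal.ofReal L * h) := by
        rw [hM, Family.boundaryMass, hh, ← ENNReal.tsum_mul_left, ← ENNReal.tsum_add,
          ← ENNReal.tsum_mul_left]
        refine ENNReal.tsum_le_tsum fun i => ?_
        obtain ⟨κ, -, -, hκ⟩ := (hdk.domain i).exists_comparison hS
          ((hdk.subset i).trans hZX) hℓ (hdk.diam_le i)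
        have hIo := (hdk.domain i).isOpen_image hS
        have h2 := (hκ _ hIo.measurableSet subset_rfl).2
        rw [inter_eq_left.2 (subset_preimage_image _ _)] at h2
        refine h2.trans (mul_le_mul_right ?_ _)
        have h3 : volume (I i) ≤ volume (innerBoundary δ (I i)) +
            ENNReal.ofReal L * volume (R (I i)) := by
          refine (measure_mono (fun x hx => ?_)).trans ((measure_union_le _ _).trans
            (add_le_add le_rfl (hst i).measure_le))
          by_cases hxb : x ∈ innerBoundary δ (I i)
          · exact Or.inl hxb
          · exact Or.inr ⟨hx, hxb⟩
        refine (mul_le_mul_right h3 κ).trans ?_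
        rw [mul_add, mul_left_comm]
        exact add_le_add (hκ _ (isOpen_innerBoundary hIo).measurableSet innerBoundary_subset).1
          (mul_le_mul_right (hκ _ (hst i).isOpen.measurableSet (hst i).subset).1 _)
      refine h1.trans ((mul_le_mul_right (add_le_add (hBbd δ hδ hδ2) le_rfl) _).trans_eq ?_)
      rw [← ENNReal.ofReal_toReal hhfin, ← ENNReal.ofReal_mul hL, ENNReal.toReal_ofReal
        ENNReal.toReal_nonneg, ← ENNReal.ofReal_add (by positivity) (by positivity),
        ← ENNReal.ofReal_mul hb.le]
      congr 1
      ring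
    refine ⟨θ * B + b * K * M.toReal + b * C * h.toReal, by positivity, fun ε hε hε2 => ?_, ?_⟩
    · have hle : lam ^ n * ε ≤ ε :=
        mul_le_of_le_one_left hε.le (pow_le_one₀ hlam.le hS.lam_lt_one.le)
      have h1 := hdk.boundaryMass_bind_le hS hℓ hZX (fun i => (hst i).decomp)
        (fun i => (hst i).subset) (fun i => (hst i).isOpen.measurableSet)
        (fun i => (hst i).boundaryMass_le ε hε hε2)
      rw [hFs]
      refine h1.trans ((mul_le_mul_right (add_le_add (add_le_add (mul_le_mul_right
        (hBbd (lam ^ n * ε) (by positivity) (hle.trans_lt hε2)) _) le_rfl) le_rfl) _).trans_eq ?_)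
      change ENNReal.ofReal b * (_ + ENNReal.ofReal (K * ε) * M + ENNReal.ofReal (C * ε) * h) = _
      conv_lhs => rw [← ENNReal.ofReal_toReal hMfin, ← ENNReal.ofReal_toReal hhfin]
      rw [← ENNReal.ofReal_mul (by positivity), ← ENNReal.ofReal_mul (by positivity),
        ← ENNReal.ofReal_mul (by positivity), ← ENNReal.ofReal_add (by positivity) (by positivity),
        ← ENNReal.ofReal_add (by positivity) (by positivity), ← ENNReal.ofReal_mul hb.le, hθ]
      congr 1
      ring
    · have h1 : (∑' i, volume ((F (k + 1)).W i)).toReal + h.toReal ≤ M.toReal := by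
        rw [← ENNReal.toReal_add (hfin (k + 1)) hhfin]
        exact ENNReal.toReal_mono (hfin k) hmass
      have h2 : M.toReal ≤ b * δ * B + b * L * h.toReal :=
        ENNReal.toReal_le_of_le_ofReal (by positivity) hlong
      refine (hpot _ _ B h.toReal ENNReal.toReal_nonneg hB ENNReal.toReal_nonneg h1 h2).trans ?_
      rw [pow_succ']
      have := mul_le_mul_of_nonneg_left hBM hκ0.le
      linarith

/-! ### From branches onto Z to an inducing scheme -/

/-- A disjoint family of branches onto `Z` that exhausts `Z` exponentially fast gives an inducing
scheme. -/
theorem hasFullBranchedInducingScheme_of_branches (hS : IsExpandingSystem T X P lam ε₁ α D)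
    (hα1 : α ≤ 1) {Z : Set (Space d)} (hZo : IsOpen Z) (hZX : Z ⊆ X)
    (hZdiam : ∀ x ∈ Z, ∀ y ∈ Z, dist x y ≤ ε₁) (hZreg : HasRegularFrontier X Z)
    {F : Family d} (hne : ∀ i, (F.W i).Nonempty)
    (hdom : ∀ i, IsBranchDomain T P (F.n i) (F.W i)) (hsub : ∀ i, F.W i ⊆ Z)
    (htime : ∀ i, 1 ≤ F.n i) (himg : ∀ i, T^[F.n i] '' F.W i = Z)
    (hdisj : Pairwise (Function.onFun Disjoint F.W)) {C κ : ℝ} (hκ0 : 0 < κ) (hκ1 : κ < 1)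
    (htail : ∀ n, volume (Z \ ⋃ i ∈ {i | F.n i ≤ n}, F.W i) ≤ ENNReal.ofReal (C * κ ^ n)) :
    HasFullBranchedInducingScheme T X P Z := by
  classical
  have hpart := hS.invertible.partition
  -- The value 1 off the branches matters within Z only on a null set.
  let τ : Space d → ℕ := fun x => if h : ∃ i, x ∈ F.W i then F.n h.choose else 1
  have hτ : ∀ i, ∀ x ∈ F.W i, τ x = F.n i := by
    intro i x hx
    have h : ∃ i, x ∈ F.W i := ⟨i, hx⟩
    have heq : h.choose = i := by
      by_contra hne
      exact disjoint_left.1 (hdisj hne) h.choose_spec hx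
    simp only [τ, dif_pos h, heq]
  set G : Space d → Space d := fun x => T^[τ x] x with hG
  have hGW : ∀ i, ∀ x ∈ F.W i, G x = T^[F.n i] x := fun i x hx => by rw [hG, ← hτ i x hx]
  have hGpre : ∀ i, ∀ A, F.W i ∩ G ⁻¹' A = F.W i ∩ T^[F.n i] ⁻¹' A := fun i A => by
    ext x
    simp only [mem_inter_iff, mem_preimage]
    exact and_congr_right fun hx => by rw [hGW i x hx]
  have hGimg : ∀ i, G '' F.W i = Z := fun i => (image_congr (hGW i)).trans (himg i)
  have himgdist : ∀ i, ∀ x ∈ F.W i, ∀ y ∈ F.W i, dist (T^[F.n i] x) (T^[F.n i] y) ≤ ε₁ :=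
    fun i x hx y hy => hZdiam _ (himg i ▸ mem_image_of_mem _ hx) _ (himg i ▸ mem_image_of_mem _ hy)
  -- Outside Z the partition `P` is kept, minus the closure of Z to retain open sets; the frontier
  -- of Z is null in X by regularity.
  let Q : Set (Set (Space d)) := range F.W ∪ {W | W.Nonempty ∧ ∃ O ∈ P, W = O \ closure Z}
  have hQZ : {W ∈ Q | W ⊆ Z} = range F.W := by
    ext W
    constructor
    · rintro ⟨h | ⟨⟨x, hx⟩, O, -, rfl⟩, hWZ⟩
      · exact h
      · exact absurd (subset_closure (hWZ hx)) hx.2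
    · rintro ⟨i, rfl⟩
      exact ⟨Or.inl ⟨i, rfl⟩, hsub i⟩
  have hnull : volume (Z \ ⋃ i, F.W i) = 0 := by
    have hlim : Tendsto (fun n : ℕ => ENNReal.ofReal (C * κ ^ n)) atTop
        (𝓝 (ENNReal.ofReal (C * 0))) :=
      ENNReal.tendsto_ofReal ((tendsto_pow_atTop_nhds_zero_of_lt_one hκ0.le hκ1).const_mul C)
    rw [mul_zero, ENNReal.ofReal_zero] at hlim
    refine le_antisymm (ge_of_tendsto' hlim fun n => (measure_mono ?_).trans (htail n)) zero_le
    exact sdiff_subset_sdiff_right (iUnion₂_subset fun i _ => subset_iUnion F.W i)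
  have hdisj' : (range F.W).PairwiseDisjoint id := by
    rintro _ ⟨i, rfl⟩ _ ⟨j, rfl⟩ hij
    exact hdisj fun h => hij (by rw [h])
  refine ⟨Q, τ, ⟨?_, ?_, ?_, ?_, ?_, ?_⟩, ?_, ?_, ?_, ?_, C, κ, hκ0, hκ1, fun n => ?_⟩
  · refine (countable_range F.W).union ((hpart.countable.image fun O => O \ closure Z).mono ?_)
    rintro W ⟨-, O, hO, rfl⟩
    exact mem_image_of_mem _ hO
  · rintro W (⟨i, rfl⟩ | ⟨-, O, hO, rfl⟩)
    · exact (hdom i).isOpen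
    · exact (hpart.isOpen O hO).sdiff isClosed_closure
  · rintro W (⟨i, rfl⟩ | ⟨hW, -⟩)
    · exact hne i
    · exact hW
  · rintro W (⟨i, rfl⟩ | ⟨-, O, hO, rfl⟩)
    · exact (hsub i).trans hZX
    · exact sdiff_subset.trans (hpart.subset O hO)
  · rintro W (hW | ⟨-, O, hO, rfl⟩) W' (hW' | ⟨-, O', hO', rfl⟩) hWW'
    · exact hdisj' hW hW' hWW'
    · obtain ⟨i, rfl⟩ := hW
      exact disjoint_sdiff_right.mono_left ((hsub i).trans subset_closure)
    · obtain ⟨i, rfl⟩ := hW'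
      exact disjoint_sdiff_left.mono_right ((hsub i).trans subset_closure)
    · exact (hpart.disjoint hO hO' fun h => hWW' (by rw [h])).mono sdiff_subset sdiff_subset
  · refine measure_mono_null (fun x hx => ?_) (measure_union_null hpart.cover
      (measure_union_null hZreg.volume_frontier hnull))
    by_contra h
    simp only [mem_union, not_or] at h
    obtain ⟨h1, h2, h3⟩ := h
    have hxP : x ∈ ⋃₀ P := by
      by_contra h
      exact h1 ⟨hx.1, h⟩
    obtain ⟨O, hO, hxO⟩ := hxP
    by_cases hxZ : x ∈ Z
    · have : x ∈ ⋃ i, F.W i := by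
        by_contra h
        exact h3 ⟨hxZ, h⟩
      obtain ⟨i, hi⟩ := mem_iUnion.1 this
      exact hx.2 ⟨_, Or.inl ⟨i, rfl⟩, hi⟩
    · have hxc : x ∉ closure Z := fun hc => h2 ⟨hx.1, by rw [hZo.frontier_eq]; exact ⟨hc, hxZ⟩⟩
      exact hx.2 ⟨O \ closure Z, Or.inr ⟨⟨x, hxO, hxc⟩, O, hO, rfl⟩, hxO, hxc⟩
  · rintro W (⟨i, rfl⟩ | ⟨-, O, hO, rfl⟩)
    · exact (hdom i).exists_subset (htime i)
    · exact ⟨O, hO, sdiff_subset⟩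
  · intro x _
    by_cases h : ∃ i, x ∈ F.W i
    · obtain ⟨i, hi⟩ := h
      rw [hτ i x hi]
      exact htime i
    · simp only [τ, dif_neg h, le_refl]
  · intro W hW hWZ x hx y hy
    obtain ⟨i, rfl⟩ : W ∈ range F.W := hQZ ▸ ⟨hW, hWZ⟩
    rw [hτ i x hx, hτ i y hy]
  · rw [hQZ]
    refine ⟨⟨⟨countable_range _, ?_, ?_, ?_, hdisj', ?_⟩, ?_, ?_, ?_⟩, ?_,
      ⟨lam, hS.lam_pos, hS.lam_lt_one, ?_⟩,
      α, iteratedDistortion lam α D, hS.exponent_pos, hα1, hS.iteratedDistortion_nonneg, ?_⟩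
    · rintro _ ⟨i, rfl⟩
      exact (hdom i).isOpen
    · rintro _ ⟨i, rfl⟩
      exact hne i
    · rintro _ ⟨i, rfl⟩
      exact hsub i
    · rwa [sUnion_range]
    · rintro _ ⟨i, rfl⟩
      exact mapsTo_iff_image_subset.2 (hGimg i).subset
    · rintro _ ⟨i, rfl⟩
      have : (F.W i).domRestrict G = (F.W i).domRestrict T^[F.n i] :=
        funext fun x => hGW i x x.2
      rw [this]
      exact (hdom i).isOpenEmbedding hS
    · rintro _ ⟨i, rfl⟩ A hA hAZ
      rw [hGimg] at hAZ
      rw [hGpre]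
      obtain ⟨κ', hκ'0, hκ't, hκ'⟩ := (hdom i).exists_comparison hS ((hsub i).trans hZX) le_rfl
        (Metric.diam_le_of_forall_dist_le hS.scale_pos.le (by rw [himg i]; exact hZdiam))
      obtain ⟨h1, h2⟩ := hκ' A hA (by rwa [himg i])
      constructor
      · intro h
        rw [h, nonpos_iff_eq_zero, mul_eq_zero] at h1
        exact h1.resolve_left hκ'0
      · intro h
        rw [h, mul_zero, mul_zero] at h2
        exact le_antisymm h2 zero_le
    · rintro _ ⟨i, rfl⟩
      exact hGimg i
    · rintro ε _ ⟨i, rfl⟩ x hx y hy -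
      have h : dist x y ≤ lam * dist (T^[F.n i] x) (T^[F.n i] y) := by
        refine ((hdom i).dist_le hS hx hy (himgdist i x hx y hy)).trans
          (mul_le_mul_of_nonneg_right ?_ dist_nonneg)
        exact pow_le_of_le_one hS.lam_pos.le hS.lam_lt_one.le (by have := htime i; omega)
      rw [← hGW i x hx, ← hGW i y hy] at h
      exact h
    · rintro _ ⟨i, rfl⟩
      obtain ⟨J, ⟨hJm, hJ⟩, hJd⟩ := (hdom i).exists_jacobian hS (himgdist i)
      rw [himg i] at hJd
      refine ⟨J, ⟨hJm, fun A hA hAZ => ?_⟩, ?_⟩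
      · rw [hGimg] at hAZ
        rw [hGpre, hJ A hA (by rwa [himg i])]
      · rw [hGimg]
        exact hJd
  · refine (measure_mono ?_).trans (htail n)
    rintro x ⟨hxZ, hx⟩
    refine ⟨hxZ, fun h => ?_⟩
    obtain ⟨i, hi, hxi⟩ := mem_iUnion₂.1 h
    rw [hτ i x hxi] at hx
    exact absurd hi (not_le.2 hx)

/-- The inducing scheme given by the iterated inducing procedure. -/
theorem hasFullBranchedInducingScheme_of_step (hS : IsExpandingSystem T X P lam ε₁ α D)
    (hα1 : α ≤ 1) {ℓ ε₂ s K L C δ θ : ℝ} {n N : ℕ} (hℓ0 : 0 < ℓ) (hℓ : ℓ ≤ ε₁) (hs : 0 ≤ s)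
    (hK : 0 ≤ K) (hL : 0 ≤ L) (hC : 0 ≤ C) (hδ : 0 < δ) (hδ2 : δ < ε₂)
    (hθ : θ = distortionFactor lam α D ℓ * (1 + s) * lam ^ n) (hθ1 : θ < 1)
    (hsmall : distortionFactor lam α D ℓ * K * (distortionFactor lam α D ℓ * δ) ≤ (1 - θ) / 2)
    {Z : Set (Space d)} (hZo : IsOpen Z) (hZX : Z ⊆ X) (hZdiam : ∀ x ∈ Z, ∀ y ∈ Z, dist x y ≤ ℓ)
    (hZreg : HasRegularFrontier X Z) (hN : 1 ≤ N)
    (hind : ∀ I : Set (Space d), IsOpen I → I ⊆ X → Metric.diam I ≤ ℓ →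
      ∃ (F : Family d) (R : Set (Space d)) (t : ℕ),
        IsInducingStep T P lam ℓ ε₂ s K L C δ n N Z I F R t) :
    HasFullBranchedInducingScheme T X P Z := by
  obtain ⟨F, R, t, Φ, κ, hΦ, hκ0, hκ1, hF, hFn, hR, hvol⟩ := exists_inducing_families hS hℓ hs hK
    hL hC hδ hδ2 hθ hθ1 hsmall hZo hZX (Metric.diam_le_of_forall_dist_le hℓ0.le hZdiam) hZreg hind
  let H : (Σ k, (F k).ι) → Set (Space d) := fun p =>
    (F p.1).W p.2 ∩ T^[(F p.1).n p.2] ⁻¹' R p.1 p.2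
  have hHR : ∀ p, (H p).Nonempty → (R p.1 p.2).Nonempty := fun p hp =>
    ⟨_, hp.choose_spec.2⟩
  have hHdisj : ∀ p q : Σ k, (F k).ι, p.1 < q.1 → Disjoint (H p) (H q) := by
    intro p q hpq
    refine Disjoint.symm (((hF q.1).disjoint_hole q.2).mono inter_subset_left ?_)
    exact fun x hx => mem_iUnion₂.2 ⟨p.1, hpq, mem_iUnion.2 ⟨p.2, hx⟩⟩
  have hNpos : (0 : ℝ) < N := by exact_mod_cast hN
  -- Each step lasts at most N iterates, so the rate κ per step is at worst κ^{1/N} per iterate.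
  set μ := κ ^ ((N : ℝ)⁻¹)
  have hμN : μ ^ N = κ := Real.rpow_inv_natCast_pow hκ0.le (by omega)
  have hμ0 : 0 < μ := Real.rpow_pos_of_pos hκ0 _
  have hμ1 : μ < 1 := Real.rpow_lt_one hκ0.le hκ1 (inv_pos.2 hNpos)
  refine hasFullBranchedInducingScheme_of_branches hS hα1 hZo hZX
    (fun x hx y hy => (hZdiam x hx y hy).trans hℓ) hZreg
    (F := ⟨{p : Σ k, (F k).ι // (H p).Nonempty}, inferInstance, fun p => H p.1,
      fun p => (F p.1.1).n p.1.2 + t p.1.1 p.1.2⟩)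
    (fun p => p.2) (fun p => ?_) (fun p => ?_) (fun p => ?_) (fun p => ?_) ?_ (C := Φ / κ) hμ0 hμ1
    (fun m => ?_)
  · exact ((hF p.1.1).domain p.1.2).comp hS ((hR p.1.1 p.1.2).2.2.2 (hHR p.1 p.2)).1
  · exact inter_subset_left.trans ((hF p.1.1).subset p.1.2)
  · exact (hR p.1.1 p.1.2).2.1.trans (Nat.le_add_left _ _)
  · exact (image_iterate_add_inter_preimage (hR p.1.1 p.1.2).1).trans
      ((hR p.1.1 p.1.2).2.2.2 (hHR p.1 p.2)).2
  · rintro ⟨p, hp⟩ ⟨q, hq⟩ hpq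
    change Disjoint (H p) (H q)
    rcases lt_trichotomy p.1 q.1 with h | h | h
    · exact hHdisj p q h
    · obtain ⟨k, i⟩ := p
      obtain ⟨k', j⟩ := q
      obtain rfl : k = k' := h
      have hij : i ≠ j := fun h => hpq (by subst h; rfl)
      exact ((hF k).disjoint hij).mono inter_subset_left inter_subset_left
    · exact (hHdisj q p h).symm
  -- The holes of steps l < k have returned by time (l + 1)N ≤ kN ≤ m, so what remains at time m is
  -- covered by the k-th family. Since m ≤ N(k + 1), κ^k is at most μ^m/κ; hence the constant Φ/κ.
  · set k := m / N
    have hkm : k * N ≤ m := Nat.div_mul_le_self m N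
    have hmk : m ≤ N * (k + 1) := (Nat.lt_mul_div_succ m (by omega)).le
    have hsub : Z \ (⋃ p ∈ {p : {p : Σ k, (F k).ι // (H p).Nonempty} |
        (F p.1.1).n p.1.2 + t p.1.1 p.1.2 ≤ m}, H p.1) ⊆
        Z \ ((⋃ l < k, ⋃ i, (F l).W i ∩ T^[(F l).n i] ⁻¹' R l i) ∪ ⋃ i, (F k).W i) ∪
          ⋃ i, (F k).W i := by
      rintro x ⟨hxZ, hx⟩
      by_cases hxW : x ∈ ⋃ i, (F k).W i
      · exact Or.inr hxW
      refine Or.inl ⟨hxZ, ?_⟩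
      rintro (h | h)
      · obtain ⟨l, hl, h⟩ := mem_iUnion₂.1 h
        obtain ⟨i, hi⟩ := mem_iUnion.1 h
        refine hx (mem_iUnion₂.2 ⟨⟨⟨l, i⟩, ⟨x, hi⟩⟩, ?_, hi⟩)
        calc (F l).n i + t l i ≤ l * N + N := add_le_add (hFn l i) (hR l i).2.2.1
          _ = (l + 1) * N := by ring
          _ ≤ k * N := Nat.mul_le_mul_right N hl
          _ ≤ m := hkm
      · exact hxW h
    refine (measure_mono hsub).trans ((measure_union_le _ _).trans ?_)
    rw [(hF k).cover, zero_add]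
    refine (measure_iUnion_le _).trans ((hvol k).trans (ENNReal.ofReal_le_ofReal ?_))
    rw [div_mul_eq_mul_div, le_div_iff₀ hκ0, mul_assoc, ← pow_succ]
    refine mul_le_mul_of_nonneg_left ?_ hΦ
    rw [← hμN, ← pow_mul]
    exact pow_le_pow_of_le_one hμ0.le hμ1.le hmk

/-! ### Choice of the constants and conclusion -/

/-- Finitely many small balls with regular boundaries, one around every point of `X`. -/
theorem exists_templates (hS : IsExpandingSystem T X P lam ε₁ α D) {δ : ℝ} (hδ : 0 < δ) :
    ∃ (m : ℕ) (B : Fin m → Set (Space d)), (∀ j, IsOpen (B j)) ∧ (∀ j, Metric.diam (B j) ≤ δ) ∧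
      (∀ j, HasRegularFrontier X (B j)) ∧ ∀ x ∈ X, ∃ j, x ∈ B j ∧ B j ⊆ Metric.ball x δ := by
  obtain ⟨t, htfin, ht⟩ := Metric.totallyBounded_iff.1
    (hS.bounded.isCompact_closure.totallyBounded.subset subset_closure) (δ / 4) (by positivity)
  obtain ⟨m, a, -, hrange⟩ := htfin.fin_param
  have hreg := fun j => hS.exists_regular_sublevel (LipschitzWith.dist_left (a j))
    (ρ := δ / 4) (ρ' := δ / 2) (by linarith)
  choose r hr hreg using hreg
  refine ⟨m, fun j => Metric.ball (a j) (r j), fun j => Metric.isOpen_ball, fun j => ?_,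
    fun j => hreg j, fun x hx => ?_⟩
  · have := (hr j).1
    have := (hr j).2
    exact (Metric.diam_ball (by linarith)).trans (by linarith)
  · obtain ⟨y, hy, hxy⟩ := mem_iUnion₂.1 (ht hx)
    rw [← hrange] at hy
    obtain ⟨j, rfl⟩ := hy
    rw [Metric.mem_ball] at hxy
    refine ⟨j, Metric.mem_ball.2 (hxy.trans (hr j).1), Metric.ball_subset_ball' ?_⟩
    rw [dist_comm]
    have := (hr j).2
    linarith

/-- At small scales, the expansion of `T^n` dominates its complexity and its distortion. -/
theorem exists_small_scale (hα : 0 < α) {c ε : ℝ} (hc : c < 1) (hε : 0 < ε) :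
    ∃ ℓ, 0 < ℓ ∧ ℓ ≤ ε ∧ distortionFactor lam α D ℓ * c < 1 := by
  have hcont : ContinuousAt (fun ℓ => distortionFactor lam α D ℓ * c) 0 := by
    have := (Real.continuous_rpow_const hα.le).continuousAt (x := (0 : ℝ))
    unfold distortionFactor
    fun_prop
  have h0 : distortionFactor lam α D 0 * c < 1 := by
    simpa [distortionFactor, Real.zero_rpow hα.ne'] using hc
  have hev : ∀ᶠ ℓ in 𝓝[>] (0 : ℝ), distortionFactor lam α D ℓ * c < 1 :=
    (hcont.eventually_lt continuousAt_const h0).filter_mono nhdsWithin_le_nhds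
  obtain ⟨ℓ, hℓ, hℓ'⟩ := (hev.and (Ioc_mem_nhdsGT hε)).exists
  exact ⟨ℓ, hℓ'.1, hℓ'.2, hℓ⟩

/-- An open set with recurrent part of positive measure contains a cube with an inducing scheme. -/
theorem exists_inducing_cube (hd : 1 ≤ d) (hS : IsExpandingSystem T X P lam ε₁ α D)
    (hα1 : α ≤ 1) (hXpos : 0 < volume X) {n₀ : ℕ} {ε₂ σ : ℝ}
    (hcomp : ControlledComplexity T X P lam n₀ ε₂ σ) (herg : QuasiErgodic T (volume.restrict X))
    {U : Set (Space d)} (hU : IsOpen U) (hrec : 0 < volume (recurrentPart T X U)) :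
    ∃ (a : Space d) (r : ℝ), 0 < r ∧ openCube a r ⊆ U ∩ X ∧ IsOpen (openCube a r) ∧
      HasFullBranchedInducingScheme T X P (openCube a r) := by
  obtain ⟨hε₂, hσ, hσ1, hcomp, C, hcompC⟩ := hcomp
  have hlam := hS.lam_pos
  -- For n₀ = 0 the hypothesis would read 0 ≤ σ < 0.
  have hn₀ : 1 ≤ n₀ := by
    by_contra! h
    obtain rfl : n₀ = 0 := by omega
    norm_num at hσ1
    linarith
  have hlamn : 0 < lam ^ n₀ := pow_pos hlam n₀
  obtain ⟨ℓ, hℓ0, hℓ, hθ1⟩ := exists_small_scale (lam := lam) (D := D) hS.exponent_pos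
    (c := (1 + σ) * lam ^ n₀) (by
      have := mul_lt_mul_of_pos_right hσ1 hlamn
      rw [sub_mul, inv_mul_cancel₀ hlamn.ne'] at this
      linarith) (lt_min hS.scale_pos hε₂)
  rw [← mul_assoc] at hθ1
  have hℓ1 := hℓ.trans (min_le_left _ _)
  have hℓ2 := hℓ.trans (min_le_right _ _)
  obtain ⟨K, hK, hstep⟩ := exists_hasStep hS hd n₀ hσ hℓ0 hℓ2 hcomp
  -- Returns to Z are followed one iterate at a time, so a bound for T itself is needed: `C` if 1 <
  -- n₀ and σ if n₀ = 1. No contraction is required of it.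
  obtain ⟨K', hK', hstep'⟩ := exists_hasStep hS hd 1 (s := max C σ) (le_max_of_le_right hσ) hℓ0 hℓ2
    (by
      intro I hI hIX hdiam ε hε hε2
      rcases hn₀.eq_or_lt with h | h
      · refine le_trans ?_ (ENNReal.ofReal_le_ofReal (le_max_right C σ))
        rw [h]
        exact hcomp I hI hIX hdiam ε hε hε2
      · exact (hcompC 1 le_rfl h I hI hIX hdiam ε hε hε2).trans
          (ENNReal.ofReal_le_ofReal (le_max_left C σ)))
  have hb := distortionFactor_pos lam α D ℓ
  set b := distortionFactor lam α D ℓ with hbdef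
  obtain ⟨θ, hθ⟩ : ∃ θ, θ = b * (1 + σ) * lam ^ n₀ := ⟨_, rfl⟩
  rw [← hθ] at hθ1
  have hθ' : 0 < 1 - θ := sub_pos.2 hθ1
  obtain ⟨δ, hδ, hδ2, hδℓ, hδK, hδK'⟩ : ∃ δ, 0 < δ ∧ δ < ε₂ ∧ δ ≤ ℓ ∧
      b * K / (1 - θ) * δ ≤ 1 / 4 ∧ b * K * (b * δ) ≤ (1 - θ) / 2 := by
    refine ⟨min (min (ε₂ / 2) ℓ) (min ((1 - θ) / (4 * (b * K + 1)))
      ((1 - θ) / (2 * (b * K * b + 1)))), by positivity, ?_, ?_, ?_, ?_⟩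
    · exact ((min_le_left _ _).trans (min_le_left _ _)).trans_lt (by linarith)
    · exact (min_le_left _ _).trans (min_le_right _ _)
    · refine (mul_le_mul_of_nonneg_left ((min_le_right _ _).trans (min_le_left _ _))
        (by positivity)).trans ?_
      rw [div_mul_div_comm, div_le_div_iff₀ (by positivity) (by norm_num)]
      nlinarith
    · rw [← mul_assoc]
      refine (mul_le_mul_of_nonneg_left ((min_le_right _ _).trans (min_le_right _ _))
        (by positivity)).trans ?_
      rw [mul_div_assoc', div_le_div_iff₀ (by positivity) (by norm_num)]
      nlinarith
  obtain ⟨m, B, hB, hBdiam, hBreg, hcov⟩ := exists_templates hS hδ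
  -- The radius ℓ/64 makes the diameter of Z at most ℓ/32, the size that cells can be chosen not to
  -- cut.
  obtain ⟨a, r, hr, hZo, haZ, hZsub, hZball, hZreg, hreach⟩ := exists_target_cube hS herg hXpos hB
    (fun A hA hne hAX => measure_frequently_reaches_pos hS hn₀ hℓ0 hℓ1 hσ hK hstep hθ hθ1 hδ hδ2
      hδK hB hcov hA hne hAX) hU hrec (η := ℓ / 64) (by positivity)
  have hZX := hZsub.trans inter_subset_right
  have hZdiam : ∀ x ∈ openCube a r, ∀ y ∈ openCube a r, dist x y ≤ ℓ / 32 := by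
    intro x hx y hy
    have h1 := Metric.mem_ball.1 (hZball hx)
    have h2 := Metric.mem_ball.1 (hZball hy)
    have h3 := dist_triangle_right x y a
    linarith
  obtain ⟨L, C', N, hL, hC', hN, hind⟩ := exists_inducing_step hS hℓ1 hℓ0 hσ hstep
    (le_max_of_le_right hσ) hK' hstep' ⟨a, haZ⟩ hZX hZdiam hZreg hδ hB
    (fun j => (hBdiam j).trans hδℓ) hBreg hcov hreach
  exact ⟨a, r, hr, hZsub, hZo, hasFullBranchedInducingScheme_of_step hS hα1 hℓ0 hℓ1 hσ hK hL hC'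
    hδ hδ2 hθ hθ1 hδK' hZo hZX (fun x hx y hy => (hZdiam x hx y hy).trans (by linarith)) hZreg hN
    hind⟩

theorem volume_recurrentPart_univ_pos
    (hXpos : 0 < volume X) : 0 < volume (recurrentPart T X univ) := by
  convert hXpos using 2
  simp only [recurrentPart, inter_univ, mem_univ, frequently_const]
  exact sep_eq_self_iff_mem_true.2 fun _ _ => trivial

end PiecewiseExpanding

theorem mainTheorem2 (d : ℕ) (hd : 1 ≤ d)
    (X : Set (PiecewiseExpanding.Space d)) (hXb : Bornology.IsBounded X)
    (hXm : MeasurableSet X) (hXpos : 0 < volume X)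
    (hXbd : PiecewiseExpanding.HasRegularBoundary X)
    (T : PiecewiseExpanding.Space d → PiecewiseExpanding.Space d)
    (P : Set (Set (PiecewiseExpanding.Space d)))
    (hT : PiecewiseExpanding.IsPiecewiseInvertible T X P)
    (lam ε₁ : ℝ) (hlam : 0 < lam) (hlam1 : lam < 1) (hε₁ : 0 < ε₁)
    (hexp : PiecewiseExpanding.UniformExpansion T P lam ε₁)
    (α D : ℝ) (hα : 0 < α) (hα1 : α ≤ 1) (hD : 0 ≤ D)
    (hdist : PiecewiseExpanding.BoundedDistortion T P α D)
    (n₀ : ℕ) (ε₂ σ : ℝ)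
    (hcomp : PiecewiseExpanding.ControlledComplexity T X P lam n₀ ε₂ σ)
    (herg : QuasiErgodic T (volume.restrict X)) :
    (∃ Z : Set (PiecewiseExpanding.Space d), IsOpen Z ∧ Z.Nonempty ∧ Z ⊆ X ∧
      PiecewiseExpanding.HasFullBranchedInducingScheme T X P Z) ∧
    (∀ U : Set (PiecewiseExpanding.Space d), IsOpen U →
      0 < volume (PiecewiseExpanding.recurrentPart T X U) →
      ∃ (a : PiecewiseExpanding.Space d) (r : ℝ), 0 < r ∧
        PiecewiseExpanding.openCube a r ⊆ U ∩ X ∧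
        PiecewiseExpanding.HasFullBranchedInducingScheme T X P
          (PiecewiseExpanding.openCube a r)) := by
  have hS : PiecewiseExpanding.IsExpandingSystem T X P lam ε₁ α D :=
    ⟨hXb, hXm, hT, herg.toQuasiMeasurePreserving, hlam, hlam1, hε₁, hexp, hα, hD, hdist⟩
  refine ⟨?_, fun U hU hrec => ?_⟩
  -- With U the whole space, every point of X is recurrent.
  · obtain ⟨a, r, hr, hsub, hopen, hZ⟩ := PiecewiseExpanding.exists_inducing_cube hd hS hα1 hXpos
      hcomp herg isOpen_univ (PiecewiseExpanding.volume_recurrentPart_univ_pos hXpos)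
    exact ⟨_, hopen, ⟨a, fun i => by simpa using hr⟩, hsub.trans inter_subset_right, hZ⟩
  · obtain ⟨a, r, hr, hsub, -, hZ⟩ := PiecewiseExpanding.exists_inducing_cube hd hS hα1 hXpos
      hcomp herg hU hrec
    exact ⟨a, r, hr, hsub, hZ⟩
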